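/- Let $K$ be a commutative ring, $\iota\colon N\to M$ a homomorphism of $K$-algebras, and suppose that the extension $M/N$ is - irreducible: $K\to M$ is injective and its image is the centralizer $R=C_M(N)$ (so $R=K$); - Frobenius: there are an $N$-$N$-bimodule map $E\colon M\to N$ and $x_i,y_i\in M$ with $\sum_i x_iE(y_im)=m=\sum_i E(mx_i)y_i$ for all $m\in M$; - of depth two: $M\otimes_N M$ is a direct summand of $M^n$ for some $n\ge 1$, both as $N$-$M$-bimodule and as $M$-$N$-bimodule. Let $A=\mathrm{End}({}_NM_N)$ (a ring under composition) and $B=(M\otimes_N M)^N$, with elements written $b=b^1\otimes b^2$, a ring with product $bb'=b'^1b^1\otimes b^2b'^2$ and unit $1\otimes 1$. Then $A$ and $B$, with their natural $K$-module structures, are finitely generated projective over $K$ and carry Hopf algebra structures over $K$ such that the following hold. 1. The counits are $\varepsilon(\alpha)=\alpha(1)$ and $\varepsilon(b)=b^1b^2$. If $b_i\in B$, $\beta_i\in A$ satisfy $\sum_i b_i^1\otimes b_i^2\beta_i(m)=m\otimes 1$ for all $m\in M$ (a left D2 quasibasis), then $\Delta(\alpha)=\sum_i\alpha(-\,b_i^1)b_i^2\otimes\beta_i$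 and $\Delta(b)=\sum_i b_i\otimes(\beta_i(b^1)\otimes b^2)$. If $c_i\in B$, $\gamma_i\in A$ satisfy $\sum_i\gamma_i(m)c_i^1\otimes c_i^2=1\otimes m$ for all $m\in M$ (a right D2 quasibasis), then $\Delta(\alpha)=\sum_i\gamma_i\otimes c_i^1\alpha(c_i^2\,-)$. 2. $A$ and $B$ are dual Hopf algebras: the pairing $\langle b,\alpha\rangle=b^1\alpha(b^2)\in K$ is perfect and satisfies $\langle bb',\alpha\rangle=\langle b,\alpha_{(1)}\rangle\langle b',\alpha_{(2)}\rangle$, $\langle b,\alpha\alpha'\rangle=\langle b_{(1)},\alpha\rangle\langle b_{(2)},\alpha'\rangle$, $\langle 1,\alpha\rangle=\varepsilon(\alpha)$, $\langle b,1\rangle=\varepsilon(b)$ and $\langle S(b),\alpha\rangle=\langle b,S(\alpha)\rangle$. 3. $M$ is a left $A$-module algebra under $\alpha\triangleright m=\alpha(m)$. With the smash product $M\rtimes A$ (that is, $M\otimes_K A$ with $(m\rtimes\alpha)(m'\rtimes\alpha')=m\,\alpha_{(1)}(m')\rtimes\alpha_{(2)}\alpha'$), the map $m\rtimes\alpha\mapsto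 m\,\alpha(-)$ is a $K$-algebra isomorphism $M\rtimes A\cong\mathrm{End}(M_N)$, and, for every Frobenius system $(E,x_i,y_i)$, the map $m\rtimes\alpha\mapsto\sum_i m\,\alpha(x_i)\otimes y_i$ is a $K$-algebra isomorphism $M\rtimes A\cong M_1$. Here $M_1=M\otimes_N M$ is the basic construction, with product $(m\otimes m')(m''\otimes m''')=mE(m'm'')\otimes m'''$ and unit $\sum_i x_i\otimes y_i$. 4. $\mathrm{End}({}_NM)$, under composition, is a right $B$-module algebra under $\xi\triangleleft b=b^1\xi(b^2\,-)$. 5. For every Frobenius system $(E,x_i,y_i)$, the formula $\psi(\alpha)=\sum_j\alpha(x_j)y_j$ defines a Frobenius homomorphism $\psi\colon A\to K$ with $\alpha_{(1)}\psi(\alpha_{(2)})=\psi(\alpha)1_A$. Viewing $E$ as an element of $A$, one has $\psi(\alpha E)=\varepsilon(\alpha)$ for all $\alpha\in A$, and the antipode of $A$ is $S(\alpha)=E_{(1)}\psi(\alpha E_{(2)})$; in terms of any left D2 quasibasis, $S(\alpha)=\sum_{i,j}E(-\,b_i^1)b_i^2\,\alpha(\beta_i(x_j))\,y_j$. -/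

import Mathlib

open scoped TensorProduct

/-! ## Module algebras over bialgebras, smash products, dual pairings -/

section Hopf

variable {K H X : Type*} [CommRing K] [Ring H] [Bialgebra K H] [Ring X] [Algebra K X]

/-- `X` is a left `H`-module algebra under `h ▷ x := act h x`:
`X` is a left `H`-module, `h ▷ (x y) = (h₁ ▷ x) (h₂ ▷ y)` and `h ▷ 1 = ε(h) 1`. -/
structure IsLeftModuleAlgebra (act : H →ₗ[K] X →ₗ[K] X) : Prop where
  one_act : ∀ x, act 1 x = x
  mul_act : ∀ h k x, act (h * k) x = act h (act k x)
  act_mul : ∀ h x y, act h (x * y) =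
    LinearMap.mul' K X (TensorProduct.map (act.flip x) (act.flip y) (Coalgebra.comul (R := K) h))
  act_one : ∀ h, act h 1 = Coalgebra.counit (R := K) h • (1 : X)

/-- `X` is a right `H`-module algebra under `x ◁ h := act h x`:
`X` is a right `H`-module, `(x y) ◁ h = (x ◁ h₁) (y ◁ h₂)` and `1 ◁ h = ε(h) 1`. -/
structure IsRightModuleAlgebra (act : H →ₗ[K] X →ₗ[K] X) : Prop where
  act_one' : ∀ x, act 1 x = x
  act_mul' : ∀ h k x, act (h * k) x = act k (act h x)
  mul_act' : ∀ h x y, act h (x * y) =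
    LinearMap.mul' K X (TensorProduct.map (act.flip x) (act.flip y) (Coalgebra.comul (R := K) h))
  one_act' : ∀ h, act h 1 = Coalgebra.counit (R := K) h • (1 : X)

namespace Smash

/-- The diagonal action of `H` on `X ⊗ H`: `h · (x ⊗ k) = (h₁ ▷ x) ⊗ h₂ k`. -/
noncomputable def diag (act : H →ₗ[K] X →ₗ[K] X) : H →ₗ[K] Module.End K (X ⊗[K] H) :=
  TensorProduct.homTensorHomMap (RingHom.id K) X H X H ∘ₗ
    TensorProduct.map act (LinearMap.mul K H) ∘ₗ Coalgebra.comul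

/-- Left multiplication by `x` on the first factor of `X ⊗ H`. -/
noncomputable def left : X →ₗ[K] Module.End K (X ⊗[K] H) :=
  LinearMap.rTensorHom H ∘ₗ LinearMap.mul K X

/-- The multiplication `(x ⋊ h) (y ⋊ k) = x (h₁ ▷ y) ⋊ h₂ k` on `X ⊗ H`. -/
noncomputable def mul (act : H →ₗ[K] X →ₗ[K] X) :
    X ⊗[K] H →ₗ[K] Module.End K (X ⊗[K] H) :=
  TensorProduct.lift ((LinearMap.mul K (Module.End K (X ⊗[K] H))).compl₁₂ left (diag act))

theorem mul_tmul (act : H →ₗ[K] X →ₗ[K] X) (x : X) (h : H) :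
    mul act (x ⊗ₜ h) = left x * diag act h := rfl

theorem left_mul (x y : X) : (left (K := K) (H := H) (x * y)) = left x * left y := by
  ext z k
  simp [left, mul_assoc]

theorem left_one : (left (K := K) (H := H) (1 : X)) = 1 := by
  ext z k
  simp [left]

variable {act : H →ₗ[K] X →ₗ[K] X}

theorem diag_mul (hact : IsLeftModuleAlgebra act) (h k : H) :
    diag act (h * k) = diag act h * diag act k := by
  have key : ∀ s t : H ⊗[K] H,
      TensorProduct.homTensorHomMap (RingHom.id K) X H X H
        (TensorProduct.map act (LinearMap.mul K H) (s * t)) =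
      TensorProduct.homTensorHomMap (RingHom.id K) X H X H
        (TensorProduct.map act (LinearMap.mul K H) s) *
      TensorProduct.homTensorHomMap (RingHom.id K) X H X H
        (TensorProduct.map act (LinearMap.mul K H) t) := by
    intro s t
    induction s with
    | zero => simp
    | add s s' hs hs' => simp only [add_mul, map_add, hs, hs']
    | tmul a b =>
      induction t with
      | zero => simp
      | add s s' hs hs' => simp only [mul_add, map_add, hs, hs']
      | tmul c d =>
        ext z l
        simp [hact.mul_act, mul_assoc]
  simp only [diag, LinearMap.comp_apply, Bialgebra.comul_mul]
  exact key _ _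

theorem diag_one (hact : IsLeftModuleAlgebra act) : diag act 1 = 1 := by
  ext z l
  simp [diag, Bialgebra.comul_one, Algebra.TensorProduct.one_def, hact.one_act]

theorem diag_mul_left (hact : IsLeftModuleAlgebra act) (h : H) (x : X) :
    diag act h * left x = mul act (diag act h (x ⊗ₜ[K] 1)) := by
  ext y k
  -- both sides are values of one map on the two iterated coproducts
  let G : (H ⊗[K] H) ⊗[K] H →ₗ[K] X ⊗[K] H :=
    TensorProduct.map (LinearMap.mul' K X ∘ₗ TensorProduct.map (act.flip x) (act.flip y))
      (LinearMap.mulRight K k)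
  have e1 : (diag act h * left x : Module.End K (X ⊗[K] H)) (y ⊗ₜ k) =
      G ((Coalgebra.comul (R := K) (A := H)).rTensor H (Coalgebra.comul (R := K) h)) := by
    simp only [diag, left, LinearMap.comp_apply, Module.End.mul_apply, LinearMap.rTensorHom]
    generalize Coalgebra.comul (R := K) h = t
    induction t with
    | zero => simp
    | add s s' hs hs' => simp only [map_add, LinearMap.add_apply, hs, hs']
    | tmul a b => simp [G, hact.act_mul]
  have e2 : (mul act (diag act h (x ⊗ₜ[K] 1))) (y ⊗ₜ k) =
      G ((TensorProduct.assoc K H H H).symm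
        ((Coalgebra.comul (R := K) (A := H)).lTensor H (Coalgebra.comul (R := K) h))) := by
    conv_lhs => rw [diag]
    simp only [LinearMap.comp_apply]
    generalize Coalgebra.comul (R := K) h = t
    induction t with
    | zero => simp
    | add s s' hs hs' => simp only [map_add, LinearMap.add_apply, hs, hs']
    | tmul a b =>
      simp only [TensorProduct.map_tmul, TensorProduct.homTensorHomMap_apply, mul_tmul,
        LinearMap.mul_apply', mul_one, LinearMap.lTensor_tmul, diag, LinearMap.comp_apply,
        Module.End.mul_apply]
      generalize Coalgebra.comul (R := K) b = t
      induction t with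
      | zero => simp
      | add s s' hs hs' => simp only [map_add, LinearMap.add_apply, hs, hs', TensorProduct.tmul_add]
      | tmul c d => simp [G, left]
  have := Coalgebra.coassoc_symm_apply (R := K) h
  simp only [TensorProduct.AlgebraTensorModule.curry_apply, LinearMap.restrictScalars_self,
    TensorProduct.curry_apply]
  rw [e1, e2, this]

theorem mul_mul (hact : IsLeftModuleAlgebra act) (s t : X ⊗[K] H) :
    mul act (mul act s t) = mul act s * mul act t := by
  have hl : ∀ (x : X) (t : X ⊗[K] H), mul act (left x t) = left x * mul act t := by
    intro x t
    induction t with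
    | zero => simp
    | add s s' hs hs' => simp only [map_add, hs, hs', mul_add]
    | tmul y k =>
      have : (left x (y ⊗ₜ[K] k) : X ⊗[K] H) = (x * y) ⊗ₜ k := by simp [left]
      rw [this, mul_tmul, mul_tmul, left_mul, _root_.mul_assoc]
  have hr : ∀ (k : H) (t : X ⊗[K] H),
      mul act ((LinearMap.mulRight K k).lTensor X t) = mul act t * diag act k := by
    intro k t
    induction t with
    | zero => simp
    | add s s' hs hs' => simp only [map_add, hs, hs', add_mul]
    | tmul y l =>
      rw [LinearMap.lTensor_tmul, mul_tmul, mul_tmul, LinearMap.mulRight_apply, diag_mul hact,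
        _root_.mul_assoc]
  have hd : ∀ (h k : H) (y : X), diag act h (y ⊗ₜ[K] k) =
      (LinearMap.mulRight K k).lTensor X (diag act h (y ⊗ₜ[K] 1)) := by
    intro h k y
    simp only [diag, LinearMap.comp_apply]
    generalize Coalgebra.comul (R := K) h = t
    induction t with
    | zero => simp
    | add s s' hs hs' => simp only [map_add, LinearMap.add_apply, hs, hs']
    | tmul a b => simp
  induction s with
  | zero => simp
  | add s s' hs hs' => simp only [map_add, LinearMap.add_apply, hs, hs', add_mul]
  | tmul x h =>
    induction t with
    | zero => simp
    | add s s' hs hs' => simp only [map_add, hs, hs', mul_add]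
    | tmul y k =>
      rw [mul_tmul, mul_tmul, Module.End.mul_apply, hl, hd, hr, ← diag_mul_left hact]
      simp only [_root_.mul_assoc]

end Smash

/-- The smash product `X ⋊ H` of a left `H`-module algebra `X` with `H`: the additive group
`X ⊗ H` with multiplication `(x ⋊ h) (y ⋊ k) = x (h₁ ▷ y) ⋊ h₂ k` and unit `1 ⋊ 1`. -/
def SmashProduct {act : H →ₗ[K] X →ₗ[K] X} (_hact : IsLeftModuleAlgebra act) : Type _ :=
  X ⊗[K] H

namespace SmashProduct

variable {act : H →ₗ[K] X →ₗ[K] X} (hact : IsLeftModuleAlgebra act)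

noncomputable instance : AddCommGroup (SmashProduct hact) :=
  inferInstanceAs (AddCommGroup (X ⊗[K] H))

noncomputable instance : Module K (SmashProduct hact) :=
  inferInstanceAs (Module K (X ⊗[K] H))

/-- The element `x ⋊ h`. -/
def mk (x : X) (h : H) : SmashProduct hact := x ⊗ₜ[K] h

noncomputable instance : Ring (SmashProduct hact) where
  __ := (inferInstance : AddCommGroup (SmashProduct hact))
  mul s t := Smash.mul act s t
  one := mk hact 1 1
  left_distrib s t u := map_add (Smash.mul act s) t u
  right_distrib s t u := LinearMap.congr_fun (map_add (Smash.mul act) s t) u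
  zero_mul s := LinearMap.congr_fun (map_zero (Smash.mul act)) s
  mul_zero s := map_zero (Smash.mul act s)
  mul_assoc s t u := LinearMap.congr_fun (Smash.mul_mul hact s t) u
  one_mul s := by
    change Smash.mul act (1 ⊗ₜ[K] 1) s = s
    rw [Smash.mul_tmul, Smash.left_one, Smash.diag_one hact]
    rfl
  mul_one s := by
    change Smash.mul act s (1 ⊗ₜ[K] 1) = s
    induction s using TensorProduct.induction_on with
    | zero => simp
    | add s s' hs hs' => rw [map_add, LinearMap.add_apply, hs, hs']
    | tmul x h =>
      rw [Smash.mul_tmul]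
      have : Smash.diag act h ((1 : X) ⊗ₜ[K] (1 : H)) = (1 : X) ⊗ₜ[K] h := by
        have h1 : ∀ t : H ⊗[K] H, TensorProduct.homTensorHomMap (RingHom.id K) X H X H
            (TensorProduct.map act (LinearMap.mul K H) t) ((1 : X) ⊗ₜ[K] (1 : H)) =
            TensorProduct.map (LinearMap.toSpanSingleton K X 1) LinearMap.id
              ((Coalgebra.counit (R := K) (A := H)).rTensor H t) := by
          intro t
          induction t with
          | zero => simp
          | add s s' hs hs' => simp only [map_add, LinearMap.add_apply, hs, hs']
          | tmul a b => simp [hact.act_one]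
        simp only [Smash.diag, LinearMap.comp_apply]
        rw [h1, Coalgebra.rTensor_counit_comul]
        simp
      rw [Module.End.mul_apply, this]
      simp [Smash.left]

noncomputable instance : Algebra K (SmashProduct hact) :=
  Algebra.ofModule
    (fun r s t => LinearMap.congr_fun (map_smul (Smash.mul act) r s) t)
    (fun r s t => map_smul (Smash.mul act s) r t)

end SmashProduct

end Hopf

/-- `A` and `B` are dual Hopf algebras with respect to the pairing `p b a = ⟨b, a⟩`:
the pairing is perfect and exchanges products with coproducts, units with counits, and the two
antipodes. -/
structure IsHopfDuality {K A B : Type*} [CommRing K] [Ring A] [Ring B] [HopfAlgebra K A]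
    [HopfAlgebra K B] (p : B →ₗ[K] A →ₗ[K] K) : Prop where
  perfect : p.IsPerfPair
  mul_left : ∀ b b' a, p (b * b') a =
    LinearMap.mul' K K (TensorProduct.map (p b) (p b') (Coalgebra.comul (R := K) a))
  mul_right : ∀ b a a', p b (a * a') =
    LinearMap.mul' K K (TensorProduct.map (p.flip a) (p.flip a') (Coalgebra.comul (R := K) b))
  one_left : ∀ a, p 1 a = Coalgebra.counit (R := K) a
  one_right : ∀ b, p b 1 = Coalgebra.counit (R := K) b
  antipode : ∀ b a, p (HopfAlgebra.antipode K b) a = p b (HopfAlgebra.antipode K a)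

/-! ## Ring extensions -/

namespace RingExt

variable {K N M : Type*} [CommRing K] [Ring N] [Ring M] [Algebra K N] [Algebra K M]
  (ι : N →ₐ[K] M)

/-- The relations `x n ⊗ y = x ⊗ n y`. -/
def rel : Submodule K (M ⊗[K] M) :=
  Submodule.span K {t | ∃ x n y, t = (x * ι n) ⊗ₜ[K] y - x ⊗ₜ[K] (ι n * y)}

/-- The tensor square `M ⊗_N M`. As `K` acts through the centre of `N`, it is the quotient of
`M ⊗_K M` by the relations `x n ⊗ y = x ⊗ n y`. -/
abbrev TSq : Type _ := (M ⊗[K] M) ⧸ rel ι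

/-- The element `x ⊗ y` of `M ⊗_N M`, as a bilinear map. -/
noncomputable def mk : M →ₗ[K] M →ₗ[K] TSq ι :=
  (TensorProduct.mk K M M).compr₂ (rel ι).mkQ

variable {ι}

theorem mk_balanced (x : M) (n : N) (y : M) : mk ι (x * ι n) y = mk ι x (ι n * y) :=
  (Submodule.Quotient.eq _).2 (Submodule.subset_span ⟨x, n, y, rfl⟩)

theorem tsq_induction {p : TSq ι → Prop} (t : TSq ι) (hz : p 0)
    (hmk : ∀ x y, p (mk ι x y)) (hadd : ∀ s t, p s → p t → p (s + t)) : p t := by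
  obtain ⟨t, rfl⟩ := Submodule.Quotient.mk_surjective _ t
  induction t with
  | zero => exact hz
  | tmul x y => exact hmk x y
  | add s t hs ht => exact hadd _ _ hs ht

/-- The linear map on `M ⊗_N M` induced by an `N`-balanced bilinear map. -/
noncomputable def lift {P : Type*} [AddCommGroup P] [Module K P] (f : M →ₗ[K] M →ₗ[K] P)
    (hf : ∀ x n y, f (x * ι n) y = f x (ι n * y)) : TSq ι →ₗ[K] P :=
  (rel ι).liftQ (TensorProduct.lift f) (by
    rw [rel, Submodule.span_le]
    rintro _ ⟨x, n, y, rfl⟩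
    simp [hf])

@[simp] theorem lift_mk {P : Type*} [AddCommGroup P] [Module K P] (f : M →ₗ[K] M →ₗ[K] P)
    (hf : ∀ x n y, f (x * ι n) y = f x (ι n * y)) (x y : M) : lift f hf (mk ι x y) = f x y := by
  change TensorProduct.lift f (x ⊗ₜ y) = _
  simp

variable (ι)

/-- The left `M`-action on `M ⊗_N M`: `m · (x ⊗ y) = m x ⊗ y`. -/
noncomputable def lmul (m : M) : TSq ι →ₗ[K] TSq ι :=
  lift ((mk ι).comp (LinearMap.mulLeft K m)) (fun x n y => by
    simp only [LinearMap.comp_apply, LinearMap.mulLeft_apply]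
    rw [← mul_assoc, mk_balanced])

/-- The right `M`-action on `M ⊗_N M`: `(x ⊗ y) · m = x ⊗ y m`. -/
noncomputable def rmul (m : M) : TSq ι →ₗ[K] TSq ι :=
  lift ((mk ι).compl₂ (LinearMap.mulRight K m)) (fun x n y => by
    simp only [LinearMap.compl₂_apply, LinearMap.mulRight_apply]
    rw [mk_balanced, mul_assoc])

@[simp] theorem lmul_mk (m x y : M) : lmul ι m (mk ι x y) = mk ι (m * x) y := by simp [lmul]

@[simp] theorem rmul_mk (m x y : M) : rmul ι m (mk ι x y) = mk ι x (y * m) := by simp [rmul]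

/-- `M ⊗_N M` is isomorphic to a direct summand of a finite power of `M`, by additive maps that
commute with left multiplication by the elements of `P` and right multiplication by the
elements of `Q`. (All maps in question are automatically `K`-linear.) -/
def IsSummandOfPower (P Q : Set M) : Prop :=
  ∃ (n : ℕ) (_ : 0 < n) (σ : TSq ι →ₗ[K] (Fin n → M)) (π : (Fin n → M) →ₗ[K] TSq ι),
    (∀ p ∈ P, ∀ t i, σ (lmul ι p t) i = p * σ t i) ∧
    (∀ q ∈ Q, ∀ t i, σ (rmul ι q t) i = σ t i * q) ∧
    (∀ p ∈ P, ∀ v, π (fun i => p * v i) = lmul ι p (π v)) ∧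
    (∀ q ∈ Q, ∀ v, π (fun i => v i * q) = rmul ι q (π v)) ∧
    ∀ t, π (σ t) = t

/-- Left depth two: `M ⊗_N M` is a direct summand of some `Mⁿ` as an `N`-`M`-bimodule. -/
def IsLeftD2 : Prop := IsSummandOfPower ι (Set.range ι) Set.univ

/-- Right depth two: `M ⊗_N M` is a direct summand of some `Mⁿ` as an `M`-`N`-bimodule. -/
def IsRightD2 : Prop := IsSummandOfPower ι Set.univ (Set.range ι)

/-- Depth two: left and right depth two. -/
def IsDepthTwo : Prop := IsLeftD2 ι ∧ IsRightD2 ι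

/-- The extension is irreducible with `R = K`: `K` maps isomorphically onto the centralizer
`R = C_M(N)`. -/
def IsIrreducible : Prop :=
  Function.Injective (algebraMap K M) ∧ Subalgebra.centralizer K (Set.range ι) = ⊥

/-- A Frobenius system of `N → M`: a Frobenius homomorphism `E : M → N`, i.e. a bimodule map,
and dual bases `xᵢ`, `yᵢ`. (`N`-bimodule maps are automatically `K`-linear.) -/
structure FrobeniusSystem where
  E : M →ₗ[K] N
  E_left : ∀ n m, E (ι n * m) = n * E m
  E_right : ∀ m n, E (m * ι n) = E m * n
  size : ℕ
  x : Fin size → M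
  y : Fin size → M
  sum_left : ∀ m, ∑ i, x i * ι (E (y i * m)) = m
  sum_right : ∀ m, ∑ i, ι (E (m * x i)) * y i = m

/-- The extension is Frobenius. -/
def IsFrobenius : Prop := Nonempty (FrobeniusSystem ι)

/-! ### The rings `A = End(_N M_N)`, `End(_N M)`, `End(M_N)` -/

/-- `A = End(_N M_N)`, a ring under composition. -/
def A : Subring (Module.End K M) where
  carrier := {f | (∀ n m, f (ι n * m) = ι n * f m) ∧ ∀ m n, f (m * ι n) = f m * ι n}
  mul_mem' := fun {f g} hf hg => ⟨fun n m => by simp [hg.1, hf.1], fun m n => by simp [hg.2, hf.2]⟩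
  one_mem' := ⟨fun _ _ => rfl, fun _ _ => rfl⟩
  add_mem' := fun {f g} hf hg =>
    ⟨fun n m => by simp [hg.1, hf.1, mul_add], fun m n => by simp [hg.2, hf.2, add_mul]⟩
  zero_mem' := ⟨fun _ _ => by simp, fun _ _ => by simp⟩
  neg_mem' := fun {f} hf => ⟨fun n m => by simp [hf.1], fun m n => by simp [hf.2]⟩

/-- `End(_N M)`, an algebra under composition. -/
def EndLeft : Subalgebra K (Module.End K M) where
  carrier := {f | ∀ n m, f (ι n * m) = ι n * f m}
  mul_mem' := fun {f g} hf hg n m => by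
    rw [Module.End.mul_apply, hg n m, hf n (g m), Module.End.mul_apply]
  add_mem' := fun {f g} hf hg n m => by
    rw [LinearMap.add_apply, hg n m, hf n m, LinearMap.add_apply, mul_add]
  algebraMap_mem' := fun k n m => by simp [Module.algebraMap_end_apply]

/-- `End(M_N)`, an algebra under composition. -/
def EndRight : Subalgebra K (Module.End K M) where
  carrier := {f | ∀ m n, f (m * ι n) = f m * ι n}
  mul_mem' := fun {f g} hf hg m n => by
    rw [Module.End.mul_apply, hg m n, hf (g m) n, Module.End.mul_apply]
  add_mem' := fun {f g} hf hg m n => by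
    rw [LinearMap.add_apply, hg m n, hf m n, LinearMap.add_apply, add_mul]
  algebraMap_mem' := fun k m n => by simp [Module.algebraMap_end_apply]

/-! ### The ring `B = (M ⊗_N M)^N` -/

/-- The subgroup `(M ⊗_N M)^N` of `N`-central elements. -/
def central : Submodule K (TSq ι) where
  carrier := {t | ∀ n, lmul ι (ι n) t = rmul ι (ι n) t}
  add_mem' := fun hs ht n => by rw [map_add, map_add, hs n, ht n]
  zero_mem' := fun n => by simp
  smul_mem' := fun k t ht n => by rw [map_smul, map_smul, ht n]

/-- `B = (M ⊗_N M)^N`. -/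
def B : Type _ := central ι

noncomputable instance : AddCommGroup (B ι) := inferInstanceAs (AddCommGroup (central ι))

variable {ι}

/-- The underlying tensor of an element of `B`. -/
def B.val (b : B ι) : TSq ι := Subtype.val b

theorem B.prop (b : B ι) (n : N) : lmul ι (ι n) b.val = rmul ι (ι n) b.val := Subtype.property b n

theorem B.ext {b c : B ι} (h : b.val = c.val) : b = c := Subtype.ext h

theorem lmul_add (m m' : M) (t : TSq ι) : lmul ι (m + m') t = lmul ι m t + lmul ι m' t := by
  induction t using tsq_induction with
  | hz => simp
  | hmk x y => simp [add_mul]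
  | hadd s t hs ht => simp only [map_add, hs, ht]; abel

theorem rmul_add (m m' : M) (t : TSq ι) : rmul ι (m + m') t = rmul ι m t + rmul ι m' t := by
  induction t using tsq_induction with
  | hz => simp
  | hmk x y => simp [mul_add]
  | hadd s t hs ht => simp only [map_add, hs, ht]; abel

theorem lmul_smul (k : K) (m : M) (t : TSq ι) : lmul ι (k • m) t = k • lmul ι m t := by
  induction t using tsq_induction with
  | hz => simp
  | hmk x y => simp
  | hadd s t hs ht => simp only [map_add, hs, ht, smul_add]

theorem rmul_smul (k : K) (m : M) (t : TSq ι) : rmul ι (k • m) t = k • rmul ι m t := by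
  induction t using tsq_induction with
  | hz => simp
  | hmk x y => simp
  | hadd s t hs ht => simp only [map_add, hs, ht, smul_add]

theorem lmul_lmul (m m' : M) (t : TSq ι) : lmul ι m (lmul ι m' t) = lmul ι (m * m') t := by
  induction t using tsq_induction with
  | hz => simp
  | hmk x y => simp [mul_assoc]
  | hadd s t hs ht => simp only [map_add, hs, ht]

theorem rmul_rmul (m m' : M) (t : TSq ι) : rmul ι m (rmul ι m' t) = rmul ι (m' * m) t := by
  induction t using tsq_induction with
  | hz => simp
  | hmk x y => simp [mul_assoc]
  | hadd s t hs ht => simp only [map_add, hs, ht]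

theorem lmul_rmul (m m' : M) (t : TSq ι) : lmul ι m (rmul ι m' t) = rmul ι m' (lmul ι m t) := by
  induction t using tsq_induction with
  | hz => simp
  | hmk x y => simp
  | hadd s t hs ht => simp only [map_add, hs, ht]

/-- The action of `b ∈ B` on `M ⊗_N M`: `b · (x ⊗ y) = x b¹ ⊗ b² y`. -/
noncomputable def insert (b : B ι) : TSq ι →ₗ[K] TSq ι :=
  lift (LinearMap.mk₂ K (fun x y => lmul ι x (rmul ι y b.val))
    (fun x x' y => lmul_add _ _ _) (fun k x y => lmul_smul _ _ _)
    (fun x y y' => by simp only [rmul_add, map_add]) (fun k x y => by simp only [rmul_smul, map_smul]))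
    (fun x n y => by
      simp only [LinearMap.mk₂_apply]
      rw [← lmul_lmul, lmul_rmul (ι n), b.prop n, rmul_rmul])

theorem insert_mk (b : B ι) (x y : M) : insert b (mk ι x y) = lmul ι x (rmul ι y b.val) := by
  simp [insert]

theorem insert_lmul (b : B ι) (m : M) (t : TSq ι) : insert b (lmul ι m t) = lmul ι m (insert b t) := by
  induction t using tsq_induction with
  | hz => simp
  | hmk x y => simp [insert_mk, lmul_lmul]
  | hadd s t hs ht => simp only [map_add, hs, ht]

theorem insert_rmul (b : B ι) (m : M) (t : TSq ι) : insert b (rmul ι m t) = rmul ι m (insert b t) := by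
  induction t using tsq_induction with
  | hz => simp
  | hmk x y => simp [insert_mk, lmul_rmul, rmul_rmul]
  | hadd s t hs ht => simp only [map_add, hs, ht]

theorem lmul_one (t : TSq ι) : lmul ι 1 t = t := by
  induction t using tsq_induction with
  | hz => simp
  | hmk x y => simp
  | hadd s t hs ht => simp only [map_add, hs, ht]

theorem rmul_one (t : TSq ι) : rmul ι 1 t = t := by
  induction t using tsq_induction with
  | hz => simp
  | hmk x y => simp
  | hadd s t hs ht => simp only [map_add, hs, ht]

/-- The product `b b' = b'¹ b¹ ⊗ b² b'²` of `B`. -/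
noncomputable def B.mul (b b' : B ι) : B ι :=
  ⟨insert b b'.val, fun n => by rw [← insert_lmul, b'.prop n, insert_rmul]⟩

/-- The unit `1 ⊗ 1` of `B`. -/
noncomputable def B.one : B ι := ⟨mk ι 1 1, fun n => by
  have := mk_balanced (ι := ι) 1 n 1
  simpa using this⟩

theorem insert_mul (b c : B ι) (t : TSq ι) : insert (B.mul b c) t = insert b (insert c t) := by
  induction t using tsq_induction with
  | hz => simp
  | hmk x y =>
    rw [insert_mk, insert_mk, insert_lmul, insert_rmul]
    rfl
  | hadd s t hs ht => simp only [map_add, hs, ht]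

theorem insert_add (b c : B ι) (t : TSq ι) : insert (b + c) t = insert b t + insert c t := by
  have h : (b + c).val = b.val + c.val := rfl
  induction t using tsq_induction with
  | hz => simp
  | hmk x y => rw [insert_mk, insert_mk, insert_mk, h, map_add, map_add]
  | hadd s t hs ht => simp only [map_add, hs, ht]; abel

/-- The ring `B = (M ⊗_N M)^N`, with `b b' = b'¹ b¹ ⊗ b² b'²` and unit `1 ⊗ 1`. -/
noncomputable instance : Ring (B ι) :=
  { (inferInstance : AddCommGroup (B ι)) with
    mul := B.mul
    one := B.one
    left_distrib := fun b c d => B.ext (map_add (insert b) c.val d.val)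
    right_distrib := fun b c d => B.ext (insert_add b c d.val)
    zero_mul := fun c => B.ext (by
      have h := insert_add (0 : B ι) 0 c.val
      rw [add_zero] at h
      exact left_eq_add.mp h)
    mul_zero := fun c => B.ext (map_zero (insert c))
    mul_assoc := fun b c d => B.ext (insert_mul b c d.val)
    one_mul := fun c => B.ext (by
      have h : ∀ t, insert (B.one : B ι) t = t := fun t => by
        induction t using tsq_induction with
        | hz => simp
        | hmk x y =>
          rw [insert_mk]
          change lmul ι x (rmul ι y (mk ι 1 1)) = _
          simp
        | hadd s t hs ht => simp only [map_add, hs, ht]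
      exact h c.val)
    mul_one := fun c => B.ext (by
      change insert c (mk ι 1 1) = c.val
      rw [insert_mk, rmul_one, lmul_one]) }

/-! ### Operations between `A`, `B` and the endomorphism rings -/

/-- `m ↦ b¹ ξ(b² m)` for `ξ` left `N`-linear. -/
noncomputable def rightActEnd (ξ : Module.End K M) (hξ : ∀ n m, ξ (ι n * m) = ι n * ξ m) :
    TSq ι →ₗ[K] Module.End K M :=
  lift (LinearMap.mk₂ K (fun x y => LinearMap.mulLeft K x ∘ₗ ξ ∘ₗ LinearMap.mulLeft K y)
    (fun x x' y => by ext; simp [add_mul]) (fun k x y => by ext; simp)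
    (fun x y y' => by ext; simp [add_mul, mul_add]) (fun k x y => by ext; simp))
    (fun x n y => by ext; simp [hξ])

theorem rightActEnd_mk (ξ : Module.End K M) (hξ : ∀ n m, ξ (ι n * m) = ι n * ξ m) (x y m : M) :
    rightActEnd ξ hξ (mk ι x y) m = x * ξ (y * m) := by simp [rightActEnd]

theorem rightActEnd_lmul (ξ : Module.End K M) (hξ : ∀ n m, ξ (ι n * m) = ι n * ξ m) (z m : M)
    (t : TSq ι) : rightActEnd ξ hξ (lmul ι z t) m = z * rightActEnd ξ hξ t m := by
  induction t using tsq_induction with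
  | hz => simp
  | hmk x y => simp [rightActEnd_mk, mul_assoc]
  | hadd s t hs ht => simp only [map_add, LinearMap.add_apply, hs, ht, mul_add]

theorem rightActEnd_rmul (ξ : Module.End K M) (hξ : ∀ n m, ξ (ι n * m) = ι n * ξ m) (z m : M)
    (t : TSq ι) : rightActEnd ξ hξ (rmul ι z t) m = rightActEnd ξ hξ t (z * m) := by
  induction t using tsq_induction with
  | hz => simp
  | hmk x y => simp [rightActEnd_mk, mul_assoc]
  | hadd s t hs ht => simp only [map_add, LinearMap.add_apply, hs, ht]

theorem rightActEnd_right (ξ : Module.End K M) (hξ : ∀ n m, ξ (ι n * m) = ι n * ξ m)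
    (hξ' : ∀ m n, ξ (m * ι n) = ξ m * ι n) (m : M) (n : N)
    (t : TSq ι) : rightActEnd ξ hξ t (m * ι n) = rightActEnd ξ hξ t m * ι n := by
  induction t using tsq_induction with
  | hz => simp
  | hmk x y => rw [rightActEnd_mk, rightActEnd_mk, ← mul_assoc, hξ', mul_assoc]
  | hadd s t hs ht => simp only [map_add, LinearMap.add_apply, hs, ht, add_mul]

theorem EndLeft.map_left (ξ : EndLeft ι) (n : N) (m : M) : ξ.1 (ι n * m) = ι n * ξ.1 m :=
  ξ.2 n m

theorem A.map_left (α : A ι) (n : N) (m : M) : α.1 (ι n * m) = ι n * α.1 m := α.2.1 n m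

theorem A.map_right (α : A ι) (m : M) (n : N) : α.1 (m * ι n) = α.1 m * ι n := α.2.2 m n

/-- The right action `ξ ◁ b = b¹ ξ(b² -)` of `B` on `End(_N M)`. -/
noncomputable def rightAct (ξ : EndLeft ι) (b : B ι) : EndLeft ι :=
  ⟨rightActEnd ξ.1 (EndLeft.map_left ξ) b.val, fun n m => by
    rw [← rightActEnd_lmul, b.prop n, rightActEnd_rmul]⟩

/-- The element `b¹ α(b² -)` of `A`, for `α ∈ A` and `b ∈ B`. -/
noncomputable def A.rightCut (α : A ι) (b : B ι) : A ι :=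
  ⟨rightActEnd α.1 (A.map_left α) b.val,
    fun n m => by rw [← rightActEnd_lmul, b.prop n, rightActEnd_rmul],
    fun m n => rightActEnd_right _ _ (A.map_right α) m n _⟩

/-- `m ↦ α(m b¹) b²` for `α` right `N`-linear. -/
noncomputable def leftCutEnd (ξ : Module.End K M) (hξ : ∀ m n, ξ (m * ι n) = ξ m * ι n) :
    TSq ι →ₗ[K] Module.End K M :=
  lift (LinearMap.mk₂ K (fun x y => LinearMap.mulRight K y ∘ₗ ξ ∘ₗ LinearMap.mulRight K x)
    (fun x x' y => by ext; simp [add_mul, mul_add]) (fun k x y => by ext; simp)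
    (fun x y y' => by ext; simp [mul_add]) (fun k x y => by ext; simp))
    (fun x n y => by ext; simp [hξ])

theorem leftCutEnd_mk (ξ : Module.End K M) (hξ : ∀ m n, ξ (m * ι n) = ξ m * ι n) (x y m : M) :
    leftCutEnd ξ hξ (mk ι x y) m = ξ (m * x) * y := by simp [leftCutEnd]

/-- The element `α(- b¹) b²` of `A`, for `α ∈ A` and `b ∈ B`. -/
noncomputable def A.leftCut (α : A ι) (b : B ι) : A ι :=
  ⟨leftCutEnd α.1 (A.map_right α) b.val,
    fun n m => by
      generalize b.val = t
      induction t using tsq_induction with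
      | hz => simp
      | hmk x y => rw [leftCutEnd_mk, leftCutEnd_mk, mul_assoc, A.map_left α, mul_assoc]
      | hadd s t hs ht => simp only [map_add, LinearMap.add_apply, hs, ht, mul_add],
    fun m n => by
      have h1 : ∀ t : TSq ι, leftCutEnd α.1 (A.map_right α) (lmul ι (ι n) t) m =
          leftCutEnd α.1 (A.map_right α) t (m * ι n) := fun t => by
        induction t using tsq_induction with
        | hz => simp
        | hmk x y => simp [leftCutEnd_mk, mul_assoc]
        | hadd s t hs ht => simp only [map_add, LinearMap.add_apply, hs, ht]
      have h2 : ∀ t : TSq ι, leftCutEnd α.1 (A.map_right α) (rmul ι (ι n) t) m =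
          leftCutEnd α.1 (A.map_right α) t m * ι n := fun t => by
        induction t using tsq_induction with
        | hz => simp
        | hmk x y => simp [leftCutEnd_mk, mul_assoc]
        | hadd s t hs ht => simp only [map_add, LinearMap.add_apply, hs, ht, add_mul]
      rw [← h1, b.prop n, h2]⟩

/-- The map `x ⊗ y ↦ α(x) ⊗ y` of `M ⊗_N M`, for `α ∈ A`. -/
noncomputable def applyFst (α : A ι) : TSq ι →ₗ[K] TSq ι :=
  lift ((mk ι).comp α.1) (fun x n y => by
    simp only [LinearMap.comp_apply]
    rw [A.map_right α, mk_balanced])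

/-- The element `α(b¹) ⊗ b²` of `B`, for `α ∈ A` and `b ∈ B`. -/
noncomputable def B.map (α : A ι) (b : B ι) : B ι :=
  ⟨applyFst α b.val, fun n => by
    have h1 : ∀ t, applyFst α (lmul ι (ι n) t) = lmul ι (ι n) (applyFst α t) := fun t => by
      induction t using tsq_induction with
      | hz => simp
      | hmk x y => simp [applyFst, A.map_left α]
      | hadd s t hs ht => simp only [map_add, hs, ht]
    have h2 : ∀ t, applyFst α (rmul ι (ι n) t) = rmul ι (ι n) (applyFst α t) := fun t => by
      induction t using tsq_induction with
      | hz => simp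
      | hmk x y => simp [applyFst]
      | hadd s t hs ht => simp only [map_add, hs, ht]
    rw [← h1, b.prop n, h2]⟩

/-- The multiplication `M ⊗_N M → M`, `x ⊗ y ↦ x y`. -/
noncomputable def multM : TSq ι →ₗ[K] M :=
  lift (LinearMap.mul K M) (fun x n y => by simp [mul_assoc])

/-- A left D2 quasibasis: `∑ bᵢ¹ ⊗ bᵢ² βᵢ(m) = m ⊗ 1`. -/
def IsLeftQuasibasis {n : ℕ} (b : Fin n → B ι) (β : Fin n → A ι) : Prop :=
  ∀ m : M, ∑ i, rmul ι ((β i).1 m) (b i).val = mk ι m 1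

/-- A right D2 quasibasis: `∑ γᵢ(m) cᵢ¹ ⊗ cᵢ² = 1 ⊗ m`. -/
def IsRightQuasibasis {n : ℕ} (c : Fin n → B ι) (γ : Fin n → A ι) : Prop :=
  ∀ m : M, ∑ i, lmul ι ((γ i).1 m) (c i).val = mk ι 1 m

/-! ### The basic construction `M₁` -/

/-- The Frobenius homomorphism, viewed as an element of `A`. -/
noncomputable def FrobeniusSystem.toA (F : FrobeniusSystem ι) : A ι :=
  ⟨ι.toLinearMap ∘ₗ F.E, fun n m => by simp [F.E_left], fun m n => by simp [F.E_right]⟩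

/-- The basic construction `M₁ = M ⊗_N M` with the `E`-multiplication. -/
def M₁ (_F : FrobeniusSystem ι) : Type _ := TSq ι

namespace M₁

variable (F : FrobeniusSystem ι)

noncomputable instance : AddCommGroup (M₁ F) := inferInstanceAs (AddCommGroup (TSq ι))

noncomputable instance : Module K (M₁ F) := inferInstanceAs (Module K (TSq ι))

/-- The element `x ⊗ y = x e₁ y` of `M₁`. -/
noncomputable def tmul (x y : M) : M₁ F := mk ι x y

/-- The map `x ⊗ y ↦ E(m x) y`. -/
noncomputable def contract : M →ₗ[K] TSq ι →ₗ[K] M where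
  toFun m := lift (LinearMap.mk₂ K (fun x y => ι (F.E (m * x)) * y)
    (fun x x' y => by simp [mul_add, add_mul]) (fun k x y => by simp)
    (fun x y y' => by simp [mul_add]) (fun k x y => by simp))
    (fun x n y => by simp [← mul_assoc, F.E_right])
  map_add' m m' := by
    refine LinearMap.ext fun t => ?_
    induction t using tsq_induction with
    | hz => simp
    | hmk x y => simp [add_mul]
    | hadd s t hs ht => simp only [map_add, hs, ht]
  map_smul' k m := by
    refine LinearMap.ext fun t => ?_
    induction t using tsq_induction with
    | hz => simp
    | hmk x y => simp
    | hadd s t hs ht => simp only [map_add, hs, ht]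

/-- The `E`-multiplication `(m ⊗ m') (x ⊗ y) = m E(m' x) ⊗ y = m ⊗ E(m' x) y`. -/
noncomputable def mul : TSq ι →ₗ[K] TSq ι →ₗ[K] TSq ι :=
  lift (LinearMap.mk₂ K (fun m m' => mk ι m ∘ₗ contract F m')
    (fun x x' y => by ext; simp) (fun k x y => by ext; simp)
    (fun x y y' => by ext; simp) (fun k x y => by ext; simp))
    (fun x n y => by
      refine LinearMap.ext fun t => ?_
      simp only [LinearMap.mk₂_apply, LinearMap.comp_apply]
      rw [mk_balanced]
      congr 1
      induction t using tsq_induction with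
      | hz => simp
      | hmk u v => simp [contract, mul_assoc, F.E_left]
      | hadd s t hs ht => rw [map_add, map_add, ← hs, ← ht, mul_add])

theorem mul_mk (m m' x y : M) :
    mul F (mk ι m m') (mk ι x y) = mk ι (m * ι (F.E (m' * x))) y := by
  rw [mk_balanced]
  simp [mul, contract]

theorem mul_mul (s t u : TSq ι) : mul F (mul F s t) u = mul F s (mul F t u) := by
  induction s using tsq_induction with
  | hz => simp
  | hadd s s' hs hs' => simp only [map_add, LinearMap.add_apply, hs, hs']
  | hmk a b =>
  induction t using tsq_induction with
  | hz => simp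
  | hadd s s' hs hs' => simp only [map_add, LinearMap.add_apply, hs, hs']
  | hmk c d =>
  induction u using tsq_induction with
  | hz => simp
  | hadd s s' hs hs' => simp only [map_add, hs, hs']
  | hmk e f =>
    simp only [mul_mk]
    rw [← _root_.mul_assoc b, F.E_right, map_mul ι, _root_.mul_assoc]

theorem sum_mul (t : TSq ι) : mul F (∑ i, mk ι (F.x i) (F.y i)) t = t := by
  induction t using tsq_induction with
  | hz => simp
  | hadd s s' hs hs' => rw [map_add, hs, hs']
  | hmk c d =>
    simp only [map_sum, LinearMap.sum_apply, mul_mk]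
    rw [← LinearMap.sum_apply, ← map_sum, F.sum_left]

theorem mul_sum (t : TSq ι) : mul F t (∑ i, mk ι (F.x i) (F.y i)) = t := by
  induction t using tsq_induction with
  | hz => simp
  | hadd s s' hs hs' => rw [map_add, LinearMap.add_apply, hs, hs']
  | hmk c d =>
    simp only [map_sum, mul_mk, mk_balanced]
    rw [← map_sum, F.sum_right]

noncomputable instance : Ring (M₁ F) :=
  { (inferInstance : AddCommGroup (M₁ F)) with
    mul := fun s t => mul F s t
    one := ∑ i, tmul F (F.x i) (F.y i)
    left_distrib := fun s t u => map_add (mul F s) t u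
    right_distrib := fun s t u => LinearMap.congr_fun (map_add (mul F) s t) u
    zero_mul := fun s => LinearMap.congr_fun (map_zero (mul F)) s
    mul_zero := fun s => map_zero (mul F s)
    mul_assoc := mul_mul F
    one_mul := sum_mul F
    mul_one := mul_sum F }

noncomputable instance : Algebra K (M₁ F) :=
  Algebra.ofModule
    (fun r s t => LinearMap.congr_fun (map_smul (mul F) r s) t)
    (fun r s t => map_smul (mul F s) r t)

end M₁

end RingExt

/-! For `b ∈ B` and `α ∈ A` the elements `b¹ α(b²)` and `α(b¹) b²` of `M` commute with `N`, so
irreducibility makes them scalars. This gives two pairings `⟨b, α⟩` (`pairing`) and `[b, α]`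
(`copairing`). Depth two says that right quasibases are dual bases for the first and left quasibases
are dual bases for the second (`IsRightQuasibasis.isDualBases`, `IsLeftQuasibasis.isDualBases`).
Hence `A` and `B` are finite projective and in perfect duality, and the product of `B` transposes to
a coproduct on `A`.

The form of the product of `B` makes this the unique coproduct with `α₁(x) α₂(y) = α(x y)`
(`A.comul_eq`). Multiplicativity, the quasibasis formulas and the module algebra `M` all follow from
that equation. The antipode compares the two pairings, `⟨b, S(α)⟩ = [b, α]`, and its laws rest on
`⟨b, S(α) α'⟩ = α(b¹) α'(b²)` (`algebraMap_pairing_S_mul`). The Hopf structure of `B` is the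
transpose of that of `A`.

Left quasibases also invert `m ⊗ α ↦ m α(-)` onto `End(M_N)` (`bijective_mulAct`), and a Frobenius
system identifies `End(M_N)` with `M₁`. Finally `ψ` is `[-, -]` at the Casimir element `∑ xⱼ ⊗ yⱼ`,
and `ψ(α ∘ b¹E(b² -)) = [b, α]` (`ψ_mul_rightCut`). This identity turns dual bases for `[-, -]` into
a Frobenius system for `ψ`, and the definition of `S` into `S(α) = E₁ ψ(α E₂)`. -/

/-! ## Dual bases and dual coalgebras -/

/-- `c` and `γ` are dual bases (in the sense of projective modules) for the pairing `p`. -/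
structure IsDualBases {K A B κ : Type*} [CommRing K] [AddCommGroup A] [Module K A]
    [AddCommGroup B] [Module K B] [Fintype κ] (p : B →ₗ[K] A →ₗ[K] K) (c : κ → B) (γ : κ → A) :
    Prop where
  sum_left : ∀ b, ∑ i, p b (γ i) • c i = b
  sum_right : ∀ a, ∑ i, p (c i) a • γ i = a

namespace IsDualBases

section Module

variable {K A B κ : Type*} [CommRing K] [AddCommGroup A] [Module K A]
    [AddCommGroup B] [Module K B] [Fintype κ] {p : B →ₗ[K] A →ₗ[K] K} {c : κ → B} {γ : κ → A}

theorem flip (h : IsDualBases p c γ) : IsDualBases p.flip γ c :=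
  ⟨h.sum_right, h.sum_left⟩

theorem ext_left (h : IsDualBases p c γ) {b b' : B} (hb : ∀ a, p b a = p b' a) : b = b' := by
  rw [← h.sum_left b, ← h.sum_left b']
  simp only [hb]

theorem ext_right (h : IsDualBases p c γ) {a a' : A} (ha : ∀ b, p b a = p b a') : a = a' :=
  h.flip.ext_left ha

theorem finite_left (h : IsDualBases p c γ) : Module.Finite K B := by
  classical
  refine ⟨⟨Finset.univ.image c, ?_⟩⟩
  rw [eq_top_iff]
  intro b _
  rw [← h.sum_left b]
  exact Submodule.sum_mem _ fun i _ => Submodule.smul_mem _ _ (Submodule.subset_span (by simp))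

theorem projective_left (h : IsDualBases p c γ) : Module.Projective K B := by
  refine Module.Projective.of_split (M := κ → K)
    (LinearMap.pi fun i => p.flip (γ i)) (Fintype.linearCombination K c) ?_
  ext b
  simpa [Fintype.linearCombination_apply] using h.sum_left b

theorem bijective_left (h : IsDualBases p c γ) : Function.Bijective p := by
  refine ⟨fun b b' hb => h.ext_left fun a => by rw [hb], fun f => ⟨∑ i, f (γ i) • c i, ?_⟩⟩
  ext a
  conv_rhs => rw [← h.sum_right a]
  simp [mul_comm]

theorem isPerfPair (h : IsDualBases p c γ) : p.IsPerfPair :=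
  ⟨h.bijective_left, h.flip.bijective_left⟩

/-- The functional `⟨b, -⟩ ⟨b', -⟩` on `A ⊗ A`. -/
noncomputable def pair₂ (p : B →ₗ[K] A →ₗ[K] K) (b b' : B) : A ⊗[K] A →ₗ[K] K :=
  LinearMap.mul' K K ∘ₗ TensorProduct.map (p b) (p b')

@[simp] theorem pair₂_tmul (b b' : B) (a a' : A) :
    pair₂ p b b' (a ⊗ₜ a') = p b a * p b' a' := by simp [pair₂]

theorem eq_sum_pair₂ (h : IsDualBases p c γ) (t : A ⊗[K] A) :
    t = ∑ i, ∑ j, pair₂ p (c i) (c j) t • γ i ⊗ₜ[K] γ j := by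
  induction t with
  | zero => simp
  | add s t hs ht =>
    simp only [map_add, add_smul, Finset.sum_add_distrib]
    rw [← hs, ← ht]
  | tmul a a' =>
    conv_lhs => rw [← h.sum_right a, ← h.sum_right a', TensorProduct.sum_tmul]
    simp only [TensorProduct.tmul_sum, pair₂_tmul,
      TensorProduct.smul_tmul_smul]

/-- The elements `γ i ⊗ γ j` generate `A ⊗ A`, with coordinates given by pairing with `c i` and `c
j`. So identities between coproducts can be tested against elements of `B`. -/
theorem ext₂ (h : IsDualBases p c γ) {s t : A ⊗[K] A}
    (hst : ∀ b b', pair₂ p b b' s = pair₂ p b b' t) : s = t := by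
  rw [h.eq_sum_pair₂ s, h.eq_sum_pair₂ t]
  simp only [hst]

/-- The functional `⟨b, -⟩ ⟨b', -⟩ ⟨b'', -⟩` on `A ⊗ (A ⊗ A)`. -/
noncomputable def pair₃ (p : B →ₗ[K] A →ₗ[K] K) (b b' b'' : B) : A ⊗[K] (A ⊗[K] A) →ₗ[K] K :=
  LinearMap.mul' K K ∘ₗ TensorProduct.map (p b) (pair₂ p b' b'')

@[simp] theorem pair₃_tmul (b b' b'' : B) (a : A) (t : A ⊗[K] A) :
    pair₃ p b b' b'' (a ⊗ₜ t) = p b a * pair₂ p b' b'' t := by simp [pair₃]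

theorem ext₃ (h : IsDualBases p c γ) {s t : A ⊗[K] (A ⊗[K] A)}
    (hst : ∀ b b' b'', pair₃ p b b' b'' s = pair₃ p b b' b'' t) : s = t := by
  have key : ∀ t : A ⊗[K] (A ⊗[K] A),
      t = ∑ i, ∑ j, ∑ k, pair₃ p (c i) (c j) (c k) t • γ i ⊗ₜ[K] (γ j ⊗ₜ[K] γ k) := by
    intro t
    induction t with
    | zero => simp
    | add s t hs ht =>
      simp only [map_add, add_smul, Finset.sum_add_distrib]
      rw [← hs, ← ht]
    | tmul a t =>
      conv_lhs => rw [← h.sum_right a, h.eq_sum_pair₂ t, TensorProduct.sum_tmul]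
      simp only [TensorProduct.tmul_sum, pair₃_tmul,
        TensorProduct.smul_tmul_smul]
  rw [key s, key t]
  simp only [hst]

end Module

/-! ### The coalgebra dual to an algebra -/

section Coalgebra

variable {K A B κ : Type*} [CommRing K] [AddCommGroup A] [Module K A]
    [Ring B] [Algebra K B] [Fintype κ] {p : B →ₗ[K] A →ₗ[K] K} {c : κ → B} {γ : κ → A}

/-- The coproduct of `A` dual to the product of `B`. -/
noncomputable def comul (p : B →ₗ[K] A →ₗ[K] K) (c : κ → B) (γ : κ → A) : A →ₗ[K] A ⊗[K] A :=
  ∑ i, ∑ j, (p (c i * c j)).smulRight (γ i ⊗ₜ[K] γ j)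

/-- The coproduct is the transpose of the product of `B`. With `ext₂` this characterizes it, so it
does not depend on the dual bases. -/
theorem pair₂_comul (h : IsDualBases p c γ) (b b' : B) (a : A) :
    pair₂ p b b' (comul p c γ a) = p (b * b') a := by
  conv_rhs => rw [← h.sum_left b, ← h.sum_left b']
  simp only [comul, LinearMap.sum_apply, LinearMap.smulRight_apply, map_sum, map_smul, pair₂_tmul,
    Finset.sum_mul, Finset.mul_sum, smul_mul_smul_comm, LinearMap.smul_apply, smul_eq_mul]
  rw [Finset.sum_comm]
  exact Finset.sum_congr rfl fun i _ => Finset.sum_congr rfl fun j _ => by ring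

/-- The coalgebra structure on `A` dual to the algebra structure of `B`. -/
noncomputable abbrev coalgebra (h : IsDualBases p c γ) : Coalgebra K A where
  comul := comul p c γ
  counit := p 1
  coassoc := by
    ext a
    -- Tested against `b, b', b''`, coassociativity becomes associativity in `B`. The counit laws
    -- below become the unit laws in the same way.
    refine h.ext₃ fun b b' b'' => ?_
    have h1 : ∀ t, pair₃ p b b' b'' (TensorProduct.assoc K A A A
        ((comul p c γ).rTensor A t)) = pair₂ p (b * b') b'' t := by
      intro t
      induction t with
      | zero => simp
      | add s t hs ht => simp only [map_add, hs, ht]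
      | tmul x y =>
        rw [LinearMap.rTensor_tmul, pair₂_tmul, ← h.pair₂_comul]
        generalize comul p c γ x = t
        induction t with
        | zero => simp
        | add s t hs ht => simp only [TensorProduct.add_tmul, map_add, hs, ht, add_mul]
        | tmul u v => simp [mul_assoc]
    have h2 : ∀ t, pair₃ p b b' b'' ((comul p c γ).lTensor A t) = pair₂ p b (b' * b'') t := by
      intro t
      induction t with
      | zero => simp
      | add s t hs ht => simp only [map_add, hs, ht]
      | tmul x y => simp [h.pair₂_comul]
    simp only [LinearMap.comp_apply, LinearEquiv.coe_coe, h1, h2, h.pair₂_comul, mul_assoc]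
  rTensor_counit_comp_comul := by
    ext a
    apply (TensorProduct.lid K A).injective
    refine h.ext_right fun b => ?_
    have h1 : ∀ t, p b (TensorProduct.lid K A ((p 1).rTensor A t)) = pair₂ p 1 b t := by
      intro t
      induction t with
      | zero => simp
      | add s t hs ht => simp only [map_add, hs, ht]
      | tmul x y => simp
    simp [h1, h.pair₂_comul]
  lTensor_counit_comp_comul := by
    ext a
    apply (TensorProduct.rid K A).injective
    refine h.ext_right fun b => ?_
    have h1 : ∀ t, p b (TensorProduct.rid K A ((p 1).lTensor A t)) = pair₂ p b 1 t := by
      intro t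
      induction t with
      | zero => simp
      | add s t hs ht => simp only [map_add, hs, ht]
      | tmul x y => simp [mul_comm]
    simp [h1, h.pair₂_comul]

end Coalgebra

/-! ### The bialgebra and Hopf algebra dual to a Hopf algebra -/

section Hopf

variable {K A B κ : Type*} [CommRing K] [Ring A] [HopfAlgebra K A]
    [Ring B] [Algebra K B] [Fintype κ] {p : B →ₗ[K] A →ₗ[K] K} {c : κ → B} {γ : κ → A}

/-- The bialgebra structure on `B` dual to the bialgebra structure of `A`. -/
noncomputable abbrev bialgebra (h : IsDualBases p c γ)
    (hmul : ∀ b b' a, p (b * b') a = pair₂ p b b' (Coalgebra.comul a))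
    (hone : ∀ a, p 1 a = Coalgebra.counit a) : Bialgebra K B :=
  letI := h.flip.coalgebra
  Bialgebra.mk' K B
    (by change p 1 1 = 1; simp [hone])
    (by
      intro b b'
      change p (b * b') 1 = p b 1 * p b' 1
      simp [hmul, Algebra.TensorProduct.one_def])
    (by
      refine h.flip.ext₂ fun a a' => ?_
      change pair₂ p.flip a a' (IsDualBases.comul p.flip γ c 1) = _
      rw [h.flip.pair₂_comul]
      simp [hone, Algebra.TensorProduct.one_def])
    (by
      intro b b'
      refine h.flip.ext₂ fun a a' => ?_
      change pair₂ p.flip a a' (IsDualBases.comul p.flip γ c (b * b')) =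
        pair₂ p.flip a a' (IsDualBases.comul p.flip γ c b * IsDualBases.comul p.flip γ c b')
      rw [h.flip.pair₂_comul, LinearMap.flip_apply, hmul, Bialgebra.comul_mul]
      have hp : ∀ b x x', p b (x * x') = pair₂ p.flip x x' (IsDualBases.comul p.flip γ c b) :=
        fun b x x' => (h.flip.pair₂_comul x x' b).symm
      -- With the coproducts of `a` and `a'` written as finite sums, both sides become `∑ p b (a₁
      -- a'₁) * p b' (a₂ a'₂)`. This uses that the coproduct of `A` is multiplicative.
      obtain ⟨s, hs⟩ := TensorProduct.exists_finset (R := K) (Coalgebra.comul (R := K) a)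
      obtain ⟨s', hs'⟩ := TensorProduct.exists_finset (R := K) (Coalgebra.comul (R := K) a')
      have e2 : ∀ t t' : B ⊗[K] B, pair₂ p.flip a a' (t * t') =
          ∑ x ∈ s, ∑ x' ∈ s', pair₂ p.flip x.1 x'.1 t * pair₂ p.flip x.2 x'.2 t' := by
        intro t t'
        induction t with
        | zero => simp
        | add t₁ t₂ h₁ h₂ =>
          simp only [add_mul, map_add, h₁, h₂, Finset.sum_add_distrib]
        | tmul u v =>
          induction t' with
          | zero => simp
          | add t₁ t₂ h₁ h₂ =>
            simp only [mul_add, map_add, h₁, h₂, Finset.sum_add_distrib]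
          | tmul u' v' =>
            simp only [Algebra.TensorProduct.tmul_mul_tmul, pair₂_tmul, LinearMap.flip_apply,
              hmul, hs, hs', map_sum, Finset.sum_mul_sum]
            exact Finset.sum_congr rfl fun i _ => Finset.sum_congr rfl fun j _ => by ring
      rw [e2, hs, hs']
      simp only [Finset.sum_mul_sum, map_sum, Algebra.TensorProduct.tmul_mul_tmul, pair₂_tmul, hp])

/-- The Hopf algebra structure on `B` dual to the Hopf algebra structure of `A`. -/
noncomputable abbrev hopfAlgebra (h : IsDualBases p c γ)
    (hmul : ∀ b b' a, p (b * b') a = pair₂ p b b' (Coalgebra.comul a))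
    (hone : ∀ a, p 1 a = Coalgebra.counit a) (S : B →ₗ[K] B)
    (hS : ∀ b a, p (S b) a = p b (HopfAlgebra.antipode K a)) : HopfAlgebra K B where
  __ := h.bialgebra hmul hone
  antipode := S
  mul_antipode_rTensor_comul := by
    ext b
    refine h.ext_left fun a => ?_
    change p (LinearMap.mul' K B (S.rTensor B (IsDualBases.comul p.flip γ c b))) a =
      p (algebraMap K B (p b 1)) a
    obtain ⟨s, hs⟩ := TensorProduct.exists_finset (R := K) (Coalgebra.comul (R := K) a)
    have e : ∀ t, p (LinearMap.mul' K B (S.rTensor B t)) a =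
        ∑ x ∈ s, pair₂ p.flip (HopfAlgebra.antipode K x.1) x.2 t := by
      intro t
      induction t with
      | zero => simp
      | add s t hs ht => simp only [map_add, LinearMap.add_apply, hs, ht, Finset.sum_add_distrib]
      | tmul u v => simp [hmul, hs, hS]
    -- Since `S` is adjoint to the antipode of `A`, the antipode law for `b` evaluated at `a` is the
    -- law for `a` paired with `b`.
    have e' := HopfAlgebra.mul_antipode_rTensor_comul_apply (R := K) a
    rw [hs] at e'
    simp only [e, h.flip.pair₂_comul, LinearMap.flip_apply]
    rw [← map_sum]
    simp only [map_sum, LinearMap.rTensor_tmul, LinearMap.mul'_apply] at e'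
    rw [e', Algebra.algebraMap_eq_smul_one, Algebra.algebraMap_eq_smul_one]
    simp [hone, mul_comm]
  mul_antipode_lTensor_comul := by
    ext b
    refine h.ext_left fun a => ?_
    change p (LinearMap.mul' K B (S.lTensor B (IsDualBases.comul p.flip γ c b))) a =
      p (algebraMap K B (p b 1)) a
    obtain ⟨s, hs⟩ := TensorProduct.exists_finset (R := K) (Coalgebra.comul (R := K) a)
    have e : ∀ t, p (LinearMap.mul' K B (S.lTensor B t)) a =
        ∑ x ∈ s, pair₂ p.flip x.1 (HopfAlgebra.antipode K x.2) t := by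
      intro t
      induction t with
      | zero => simp
      | add s t hs ht => simp only [map_add, LinearMap.add_apply, hs, ht, Finset.sum_add_distrib]
      | tmul u v => simp [hmul, hs, hS]
    have e' := HopfAlgebra.mul_antipode_lTensor_comul_apply (R := K) a
    rw [hs] at e'
    simp only [e, h.flip.pair₂_comul, LinearMap.flip_apply]
    rw [← map_sum]
    simp only [map_sum, LinearMap.lTensor_tmul, LinearMap.mul'_apply] at e'
    rw [e', Algebra.algebraMap_eq_smul_one, Algebra.algebraMap_eq_smul_one]
    simp [hone, mul_comm]

end Hopf

end IsDualBases

/-! ### Contracting the second tensor factor with a functional -/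

section RidLTensor

variable {K A : Type*} [CommRing K] [AddCommGroup A] [Module K A] (f : A →ₗ[K] K)

theorem rid_lTensor_add (s t : A ⊗[K] A) : TensorProduct.rid K A (f.lTensor A (s + t)) =
    TensorProduct.rid K A (f.lTensor A s) + TensorProduct.rid K A (f.lTensor A t) := by
  simp

theorem rid_lTensor_sum {κ : Type*} (s : Finset κ) (x y : κ → A) :
    TensorProduct.rid K A (f.lTensor A (∑ i ∈ s, x i ⊗ₜ[K] y i)) = ∑ i ∈ s, f (y i) • x i := by
  simp

end RidLTensor

/-! ### The `K`-algebra structures of `A` and `B` -/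

namespace RingExt

variable {K N M : Type*} [CommRing K] [Ring N] [Ring M] [Algebra K N] [Algebra K M]

variable (ι : N →ₐ[K] M)

-- These instances are local because in the main theorem the scalar action belongs to the Hopf
-- structure asserted to exist.
noncomputable local instance B.instModule : Module K (B ι) := inferInstanceAs (Module K (central ι))

variable {ι}

@[simp] theorem B.val_add (b b' : B ι) : (b + b').val = b.val + b'.val := rfl

@[simp] theorem B.val_smul (k : K) (b : B ι) : (k • b).val = k • b.val := rfl

theorem B.val_mul (b b' : B ι) : (b * b').val = insert b b'.val := rfl

theorem B.val_one : (1 : B ι).val = mk ι 1 1 := rfl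

variable (ι) in
/-- The inclusion of `B` into `M ⊗_N M`. -/
noncomputable def B.valHom : B ι →ₗ[K] TSq ι := (central ι).subtype

@[simp] theorem B.valHom_apply (b : B ι) : B.valHom ι b = b.val := rfl

theorem B.val_sum {κ : Type*} (s : Finset κ) (b : κ → B ι) :
    (∑ i ∈ s, b i).val = ∑ i ∈ s, (b i).val :=
  map_sum (B.valHom ι) b s

theorem insert_smul (k : K) (b : B ι) (t : TSq ι) : insert (k • b) t = k • insert b t := by
  induction t using tsq_induction with
  | hz => simp
  | hmk x y => simp [insert_mk]
  | hadd s t hs ht => simp only [map_add, hs, ht, smul_add]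

noncomputable local instance B.instAlgebra : Algebra K (B ι) :=
  Algebra.ofModule (fun k b b' => B.ext (insert_smul k b b'.val))
    (fun k b b' => B.ext (map_smul (insert b) k b'.val))

local instance A.instSMul : SMul K (A ι) where
  smul k α := ⟨k • α.1, fun n m => by simp [A.map_left α], fun m n => by simp [A.map_right α]⟩

@[simp] theorem A.val_smul (k : K) (α : A ι) : (k • α).1 = k • α.1 := rfl

local instance A.instModule : Module K (A ι) :=
  Function.Injective.module K (A ι).subtype.toAddMonoidHom Subtype.val_injective fun _ _ => rfl

noncomputable local instance A.instAlgebra : Algebra K (A ι) :=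
  Algebra.ofModule (fun _ _ _ => rfl)
    (fun k α β => Subtype.ext (LinearMap.ext fun m => map_smul α.1 k (β.1 m)))

variable (ι) in
/-- The action of `A` on `M` by evaluation. -/
noncomputable def A.act : A ι →ₗ[K] M →ₗ[K] M where
  toFun α := α.1
  map_add' _ _ := rfl
  map_smul' _ _ := rfl

@[simp] theorem A.act_apply (α : A ι) (m : M) : A.act ι α m = α.1 m := rfl

theorem A.ext {α β : A ι} (h : ∀ m, α.1 m = β.1 m) : α = β :=
  Subtype.ext (LinearMap.ext h)

@[simp] theorem A.one_apply (m : M) : (1 : A ι).1 m = m := rfl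

@[simp] theorem A.mul_apply (α β : A ι) (m : M) : (α * β).1 m = α.1 (β.1 m) := rfl

@[simp] theorem A.add_apply (α β : A ι) (m : M) : (α + β).1 m = α.1 m + β.1 m := rfl

@[simp] theorem A.smul_apply (k : K) (α : A ι) (m : M) : (k • α).1 m = k • α.1 m := rfl

theorem A.sum_apply {κ : Type*} (s : Finset κ) (α : κ → A ι) (m : M) :
    (∑ i ∈ s, α i).1 m = ∑ i ∈ s, (α i).1 m :=
  map_sum ((A.act ι).flip m) α s

theorem tsq_exists_sum (t : TSq ι) : ∃ s : Finset (M × M), t = ∑ x ∈ s, mk ι x.1 x.2 := by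
  obtain ⟨t, rfl⟩ := Submodule.Quotient.mk_surjective _ t
  obtain ⟨s, rfl⟩ := TensorProduct.exists_finset t
  exact ⟨s, map_sum (rel ι).mkQ _ _⟩

theorem leftCutEnd_lmul (ξ : Module.End K M) (hξ : ∀ m n, ξ (m * ι n) = ξ m * ι n) (z m : M)
    (t : TSq ι) : leftCutEnd ξ hξ (lmul ι z t) m = leftCutEnd ξ hξ t (m * z) := by
  induction t using tsq_induction with
  | hz => simp
  | hmk x y => simp [leftCutEnd_mk, mul_assoc]
  | hadd s t hs ht => simp only [map_add, LinearMap.add_apply, hs, ht]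

theorem leftCutEnd_rmul (ξ : Module.End K M) (hξ : ∀ m n, ξ (m * ι n) = ξ m * ι n) (z m : M)
    (t : TSq ι) : leftCutEnd ξ hξ (rmul ι z t) m = leftCutEnd ξ hξ t m * z := by
  induction t using tsq_induction with
  | hz => simp
  | hmk x y => simp [leftCutEnd_mk, mul_assoc]
  | hadd s t hs ht => simp only [map_add, LinearMap.add_apply, hs, ht, add_mul]

theorem rmul_algebraMap (k : K) (t : TSq ι) : rmul ι (algebraMap K M k) t = k • t := by
  rw [Algebra.algebraMap_eq_smul_one, rmul_smul, rmul_one]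

theorem lmul_algebraMap (k : K) (t : TSq ι) : lmul ι (algebraMap K M k) t = k • t := by
  rw [Algebra.algebraMap_eq_smul_one, lmul_smul, lmul_one]

@[simp] theorem rmul_zero (t : TSq ι) : rmul ι 0 t = 0 := by
  simpa using rmul_smul (0 : K) (0 : M) t

@[simp] theorem lmul_zero (t : TSq ι) : lmul ι 0 t = 0 := by
  simpa using lmul_smul (0 : K) (0 : M) t

/-! ### Quasibases -/

/-- A splitting of `Mⁿ → M ⊗_N M` is read in coordinates: `bᵢ` is the image of the `i`-th unit
vector, which is `N`-central because unit vectors are, and `βᵢ(m)` is the `i`-th coordinate of `m ⊗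
1`. Right `N`-linearity of `βᵢ` comes from `m n ⊗ 1 = (m ⊗ 1) n`. -/
theorem IsLeftD2.exists_quasibasis (h : IsLeftD2 ι) :
    ∃ (n : ℕ) (b : Fin n → B ι) (β : Fin n → A ι), IsLeftQuasibasis b β := by
  obtain ⟨n, -, σ, π, hσl, hσr, hπl, hπr, hπσ⟩ := h
  have e : ∀ (i : Fin n) (m m' : M), (fun j => Pi.single (M := fun _ => M) i m j * m') =
      Pi.single i (m * m') := by
    intro i m m'
    ext j
    by_cases hij : j = i
    · subst hij; simp
    · simp [hij]
  have e' : ∀ (i : Fin n) (m m' : M), (fun j => m' * Pi.single (M := fun _ => M) i m j) =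
      Pi.single i (m' * m) := by
    intro i m m'
    ext j
    by_cases hij : j = i
    · subst hij; simp
    · simp [hij]
  refine ⟨n, fun i => ⟨π (Pi.single i 1), fun k => ?_⟩,
    fun i => ⟨LinearMap.proj i ∘ₗ σ ∘ₗ (mk ι).flip 1, fun k m => ?_, fun m k => ?_⟩, fun m => ?_⟩
  · rw [← hπl _ ⟨k, rfl⟩, ← hπr _ trivial, e, e', mul_one, one_mul]
  · simpa using hσl (ι k) ⟨k, rfl⟩ (mk ι m 1) i
  · have := hσr (ι k) trivial (mk ι m 1) i
    rw [rmul_mk, one_mul] at this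
    simpa [mk_balanced] using this
  · change ∑ i, rmul ι (σ (mk ι m 1) i) (π (Pi.single i 1)) = _
    simp only [← hπr _ trivial, e, one_mul]
    rw [← map_sum, Finset.univ_sum_single, hπσ]

theorem IsRightD2.exists_quasibasis (h : IsRightD2 ι) :
    ∃ (n : ℕ) (c : Fin n → B ι) (γ : Fin n → A ι), IsRightQuasibasis c γ := by
  obtain ⟨n, -, σ, π, hσl, hσr, hπl, hπr, hπσ⟩ := h
  have e : ∀ (i : Fin n) (m m' : M), (fun j => Pi.single (M := fun _ => M) i m j * m') =
      Pi.single i (m * m') := by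
    intro i m m'
    ext j
    by_cases hij : j = i
    · subst hij; simp
    · simp [hij]
  have e' : ∀ (i : Fin n) (m m' : M), (fun j => m' * Pi.single (M := fun _ => M) i m j) =
      Pi.single i (m' * m) := by
    intro i m m'
    ext j
    by_cases hij : j = i
    · subst hij; simp
    · simp [hij]
  refine ⟨n, fun i => ⟨π (Pi.single i 1), fun k => ?_⟩,
    fun i => ⟨LinearMap.proj i ∘ₗ σ ∘ₗ mk ι 1, fun k m => ?_, fun m k => ?_⟩, fun m => ?_⟩
  · rw [← hπl _ trivial, ← hπr _ ⟨k, rfl⟩, e, e', mul_one, one_mul]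
  · have := hσl (ι k) trivial (mk ι 1 m) i
    rw [lmul_mk, mul_one] at this
    have h1 := mk_balanced (ι := ι) 1 k m
    rw [one_mul] at h1
    simpa [← h1] using this
  · simpa using hσr (ι k) ⟨k, rfl⟩ (mk ι 1 m) i
  · change ∑ i, lmul ι (σ (mk ι 1 m) i) (π (Pi.single i 1)) = _
    simp only [← hπl _ trivial, e', mul_one]
    rw [← map_sum, Finset.univ_sum_single, hπσ]

section Quasibasis

variable {n : ℕ} {b : Fin n → B ι} {β : Fin n → A ι} {c : Fin n → B ι} {γ : Fin n → A ι}

/-- `∑ ξ(z bᵢ¹) bᵢ² βᵢ(m) = ξ(z m)`. -/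
theorem IsLeftQuasibasis.sum_leftCutEnd (h : IsLeftQuasibasis b β) (ξ : Module.End K M)
    (hξ : ∀ m n, ξ (m * ι n) = ξ m * ι n) (z m : M) :
    ∑ i, leftCutEnd ξ hξ (b i).val z * (β i).1 m = ξ (z * m) := by
  have := congr(leftCutEnd ξ hξ $(h m) z)
  simpa [leftCutEnd_mk, leftCutEnd_rmul, LinearMap.sum_apply] using this

/-- `∑ bᵢ¹ ξ(bᵢ² βᵢ(m) z) = m ξ(z)`. -/
theorem IsLeftQuasibasis.sum_rightActEnd (h : IsLeftQuasibasis b β) (ξ : Module.End K M)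
    (hξ : ∀ n m, ξ (ι n * m) = ι n * ξ m) (z m : M) :
    ∑ i, rightActEnd ξ hξ (b i).val ((β i).1 m * z) = m * ξ z := by
  have := congr(rightActEnd ξ hξ $(h m) z)
  simpa [rightActEnd_mk, rightActEnd_rmul, LinearMap.sum_apply] using this

/-- `∑ γᵢ(m) cᵢ¹ ξ(cᵢ² z) = ξ(m z)`. -/
theorem IsRightQuasibasis.sum_rightActEnd (h : IsRightQuasibasis c γ) (ξ : Module.End K M)
    (hξ : ∀ n m, ξ (ι n * m) = ι n * ξ m) (z m : M) :
    ∑ i, (γ i).1 m * rightActEnd ξ hξ (c i).val z = ξ (m * z) := by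
  have := congr(rightActEnd ξ hξ $(h m) z)
  simpa [rightActEnd_mk, rightActEnd_lmul, LinearMap.sum_apply] using this

/-- `∑ ξ(z γᵢ(m) cᵢ¹) cᵢ² = ξ(z) m`. -/
theorem IsRightQuasibasis.sum_leftCutEnd (h : IsRightQuasibasis c γ) (ξ : Module.End K M)
    (hξ : ∀ m n, ξ (m * ι n) = ξ m * ι n) (z m : M) :
    ∑ i, leftCutEnd ξ hξ (c i).val (z * (γ i).1 m) = ξ z * m := by
  have := congr(leftCutEnd ξ hξ $(h m) z)
  simpa [leftCutEnd_mk, leftCutEnd_lmul, LinearMap.sum_apply] using this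

/-- For `t = x ⊗ y` this is the quasibasis equation at `x`, multiplied on the right by `y`. The
coefficients `βᵢ(t¹) t²` become scalars once `t` lies in `B`. -/
theorem IsLeftQuasibasis.sum_rmul (h : IsLeftQuasibasis b β) (t : TSq ι) :
    ∑ i, rmul ι (leftCutEnd (β i).1 (A.map_right (β i)) t 1) (b i).val = t := by
  induction t using tsq_induction with
  | hz => simp
  | hmk x y =>
    simp only [leftCutEnd_mk, one_mul, ← rmul_rmul]
    rw [← map_sum, h x, rmul_mk, one_mul]
  | hadd s t hs ht =>
    simp only [map_add, LinearMap.add_apply, rmul_add, Finset.sum_add_distrib, hs, ht]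

theorem IsRightQuasibasis.sum_lmul (h : IsRightQuasibasis c γ) (t : TSq ι) :
    ∑ i, lmul ι (rightActEnd (γ i).1 (A.map_left (γ i)) t 1) (c i).val = t := by
  induction t using tsq_induction with
  | hz => simp
  | hmk x y =>
    simp only [rightActEnd_mk, mul_one, ← lmul_lmul]
    rw [← map_sum, h y, lmul_mk, mul_one]
  | hadd s t hs ht =>
    simp only [map_add, LinearMap.add_apply, lmul_add, Finset.sum_add_distrib, hs, ht]

end Quasibasis

/-! ### Irreducibility and scalars -/

/-- An irreducible depth two extension, with chosen quasibases. -/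
class IrrD2 (ι : N →ₐ[K] M) where
  irr : IsIrreducible ι
  leftSize : ℕ
  b : Fin leftSize → B ι
  β : Fin leftSize → A ι
  left : IsLeftQuasibasis b β
  rightSize : ℕ
  c : Fin rightSize → B ι
  γ : Fin rightSize → A ι
  right : IsRightQuasibasis c γ

theorem IsIrreducible.exists_scalar (h : IsIrreducible ι) {x : M}
    (hx : ∀ n, ι n * x = x * ι n) : ∃ k, algebraMap K M k = x := by
  have : x ∈ Subalgebra.centralizer K (Set.range ι) := by
    rw [Subalgebra.mem_centralizer_iff]
    rintro _ ⟨n, rfl⟩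
    exact hx n
  rwa [h.2, Algebra.mem_bot] at this

/-- The scalar corresponding to an element of the centralizer. -/
noncomputable def IsIrreducible.scalar (h : IsIrreducible ι) (x : M)
    (hx : ∀ n, ι n * x = x * ι n) : K :=
  (h.exists_scalar hx).choose

theorem IsIrreducible.algebraMap_scalar (h : IsIrreducible ι) (x : M)
    (hx : ∀ n, ι n * x = x * ι n) : algebraMap K M (h.scalar x hx) = x :=
  (h.exists_scalar hx).choose_spec

/-- An element `f` of `A` satisfies `n f(1) = f(n) = f(1) n`, so `f(1)` lies in the centralizer.
This is what makes `b¹ α(b²)` a scalar. -/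
theorem A.rightCut_one_comm (α : A ι) (b : B ι) (n : N) :
    ι n * (A.rightCut α b).1 1 = (A.rightCut α b).1 1 * ι n := by
  rw [← A.map_left, ← A.map_right, one_mul, mul_one]

theorem A.leftCut_one_comm (α : A ι) (b : B ι) (n : N) :
    ι n * (A.leftCut α b).1 1 = (A.leftCut α b).1 1 * ι n := by
  rw [← A.map_left, ← A.map_right, one_mul, mul_one]

theorem A.rightCut_apply (α : A ι) (b : B ι) (m : M) :
    (A.rightCut α b).1 m = rightActEnd α.1 (A.map_left α) b.val m := rfl

theorem A.leftCut_apply (α : A ι) (b : B ι) (m : M) :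
    (A.leftCut α b).1 m = leftCutEnd α.1 (A.map_right α) b.val m := rfl

theorem rightActEnd_add_left (α β : A ι) (t : TSq ι) (m : M) :
    rightActEnd (α + β).1 (A.map_left (α + β)) t m =
      rightActEnd α.1 (A.map_left α) t m + rightActEnd β.1 (A.map_left β) t m := by
  induction t using tsq_induction with
  | hz => simp
  | hmk x y => simp [rightActEnd_mk, mul_add]
  | hadd s t hs ht => simp only [map_add, LinearMap.add_apply, hs, ht]; abel

theorem rightActEnd_smul_left (k : K) (α : A ι) (t : TSq ι) (m : M) :
    rightActEnd (k • α).1 (A.map_left (k • α)) t m = k • rightActEnd α.1 (A.map_left α) t m := by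
  induction t using tsq_induction with
  | hz => simp
  | hmk x y => simp [rightActEnd_mk]
  | hadd s t hs ht => simp only [map_add, LinearMap.add_apply, hs, ht, smul_add]

theorem leftCutEnd_add_left (α β : A ι) (t : TSq ι) (m : M) :
    leftCutEnd (α + β).1 (A.map_right (α + β)) t m =
      leftCutEnd α.1 (A.map_right α) t m + leftCutEnd β.1 (A.map_right β) t m := by
  induction t using tsq_induction with
  | hz => simp
  | hmk x y => simp [leftCutEnd_mk, add_mul]
  | hadd s t hs ht => simp only [map_add, LinearMap.add_apply, hs, ht]; abel

theorem leftCutEnd_smul_left (k : K) (α : A ι) (t : TSq ι) (m : M) :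
    leftCutEnd (k • α).1 (A.map_right (k • α)) t m = k • leftCutEnd α.1 (A.map_right α) t m := by
  induction t using tsq_induction with
  | hz => simp
  | hmk x y => simp [leftCutEnd_mk]
  | hadd s t hs ht => simp only [map_add, LinearMap.add_apply, hs, ht, smul_add]

variable (ι) in
/-- The map `α ⊗ β ↦ α(x) β(y)`. -/
noncomputable def A.eval₂ (x y : M) : A ι ⊗[K] A ι →ₗ[K] M :=
  LinearMap.mul' K M ∘ₗ TensorProduct.map ((A.act ι).flip x) ((A.act ι).flip y)

@[simp] theorem A.eval₂_tmul (x y : M) (α β : A ι) :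
    A.eval₂ ι x y (α ⊗ₜ β) = α.1 x * β.1 y := by simp [A.eval₂]

theorem rightActEnd_sum {κ : Type*} (ξ : Module.End K M) (hξ : ∀ n m, ξ (ι n * m) = ι n * ξ m)
    (s : Finset κ) (x y : κ → M) (m : M) :
    rightActEnd ξ hξ (∑ i ∈ s, mk ι (x i) (y i)) m = ∑ i ∈ s, x i * ξ (y i * m) := by
  simp [rightActEnd_mk, LinearMap.sum_apply]

theorem leftCutEnd_sum {κ : Type*} (ξ : Module.End K M) (hξ : ∀ m n, ξ (m * ι n) = ξ m * ι n)
    (s : Finset κ) (x y : κ → M) (m : M) :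
    leftCutEnd ξ hξ (∑ i ∈ s, mk ι (x i) (y i)) m = ∑ i ∈ s, ξ (m * x i) * y i := by
  simp [leftCutEnd_mk, LinearMap.sum_apply]

theorem IsRightQuasibasis.eval₂_sum {n : ℕ} {c : Fin n → B ι} {γ : Fin n → A ι}
    (h : IsRightQuasibasis c γ) (α : A ι) (x y : M) :
    A.eval₂ ι x y (∑ i, γ i ⊗ₜ[K] A.rightCut α (c i)) = α.1 (x * y) := by
  simp [A.rightCut_apply, h.sum_rightActEnd]

theorem IsLeftQuasibasis.eval₂_sum {n : ℕ} {b : Fin n → B ι} {β : Fin n → A ι}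
    (h : IsLeftQuasibasis b β) (α : A ι) (x y : M) :
    A.eval₂ ι x y (∑ i, A.leftCut α (b i) ⊗ₜ[K] β i) = α.1 (x * y) := by
  simp [A.leftCut_apply, h.sum_leftCutEnd]

/-- This is the source of multiplicativity of the coproduct: if `s` and `t` split `α` and `β` over
products, then `s * t` splits `α ∘ β`. -/
theorem A.eval₂_mul {α : A ι} {s : A ι ⊗[K] A ι} (h : ∀ x y, A.eval₂ ι x y s = α.1 (x * y))
    (t : A ι ⊗[K] A ι) (x y : M) : A.eval₂ ι x y (s * t) = α.1 (A.eval₂ ι x y t) := by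
  induction t with
  | zero => simp
  | add t t' ht ht' => simp only [mul_add, map_add, ht, ht']
  | tmul β β' =>
    rw [A.eval₂_tmul, ← h]
    -- What remains holds for every tensor `s`. The hypothesis on `s` is dropped so that the
    -- induction is unconstrained.
    clear h
    induction s with
    | zero => simp
    | add t t' ht ht' => simp only [add_mul, map_add, ht, ht']
    | tmul α α' => simp

theorem B.map_val (α : A ι) (b : B ι) : (B.map α b).val = applyFst α b.val := rfl

theorem applyFst_sum {κ : Type*} (α : A ι) (s : Finset κ) (x y : κ → M) :
    applyFst α (∑ i ∈ s, mk ι (x i) (y i)) = ∑ i ∈ s, mk ι (α.1 (x i)) (y i) := by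
  simp [applyFst]

/-! ### The maps into `End(_N M)` and `End(M_N)` -/

theorem rightAct_apply (ξ : EndLeft ι) (b : B ι) (m : M) :
    (rightAct ξ b).1 m = rightActEnd ξ.1 (EndLeft.map_left ξ) b.val m := rfl

theorem EndLeft.ext {ξ η : EndLeft ι} (h : ∀ m, ξ.1 m = η.1 m) : ξ = η :=
  Subtype.ext (LinearMap.ext h)

theorem rightAct_apply_of_sum (ξ : EndLeft ι) (b : B ι) {s : Finset (M × M)}
    (hs : b.val = ∑ x ∈ s, mk ι x.1 x.2) (m : M) :
    (rightAct ξ b).1 m = ∑ x ∈ s, x.1 * ξ.1 (x.2 * m) := by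
  rw [rightAct_apply, hs, rightActEnd_sum]

variable (ι) in
/-- The right action of `B` on `End(_N M)`. -/
noncomputable def EndLeft.act : B ι →ₗ[K] EndLeft ι →ₗ[K] EndLeft ι :=
  LinearMap.mk₂ K (fun b ξ => rightAct ξ b)
    (fun b b' ξ => EndLeft.ext fun m => by
      change _ = (rightAct ξ b).1 m + (rightAct ξ b').1 m
      simp [rightAct_apply])
    (fun k b ξ => EndLeft.ext fun m => by
      change _ = k • (rightAct ξ b).1 m
      simp [rightAct_apply])
    (fun b ξ η => EndLeft.ext fun m => by
      change _ = (rightAct ξ b).1 m + (rightAct η b).1 m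
      obtain ⟨s, hs⟩ := tsq_exists_sum b.val
      simp [rightAct_apply_of_sum _ b hs, mul_add, Finset.sum_add_distrib])
    (fun k b ξ => EndLeft.ext fun m => by
      change _ = k • (rightAct ξ b).1 m
      obtain ⟨s, hs⟩ := tsq_exists_sum b.val
      simp [rightAct_apply_of_sum _ b hs, Finset.smul_sum])

@[simp] theorem EndLeft.act_apply (b : B ι) (ξ : EndLeft ι) :
    EndLeft.act ι b ξ = rightAct ξ b := rfl

theorem EndRight.map_right (ξ : EndRight ι) (m : M) (n : N) : ξ.1 (m * ι n) = ξ.1 m * ι n :=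
  ξ.2 m n

theorem EndRight.ext {ξ η : EndRight ι} (h : ∀ m, ξ.1 m = η.1 m) : ξ = η :=
  Subtype.ext (LinearMap.ext h)

theorem EndRight.smul_apply (k : K) (ξ : EndRight ι) (m : M) : (k • ξ).1 m = k • ξ.1 m := rfl

variable (ι) in
/-- The map `m ⊗ α ↦ m α(-)` from `M ⊗ A` to `End(M_N)`. -/
noncomputable def mulAct : M ⊗[K] A ι →ₗ[K] EndRight ι :=
  TensorProduct.lift (LinearMap.mk₂ K
    (fun m α => ⟨LinearMap.mulLeft K m ∘ₗ α.1, fun x n => by simp [A.map_right, mul_assoc]⟩)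
    (fun m m' α => EndRight.ext fun x => add_mul m m' (α.1 x))
    (fun k m α => EndRight.ext fun x => smul_mul_assoc k m (α.1 x))
    (fun m α α' => EndRight.ext fun x => mul_add m (α.1 x) (α'.1 x))
    (fun k m α => EndRight.ext fun x => mul_smul_comm k m (α.1 x)))

@[simp] theorem mulAct_tmul (m : M) (α : A ι) (x : M) :
    (mulAct ι (m ⊗ₜ α)).1 x = m * α.1 x := rfl

/-! ### The basic construction -/

namespace FrobeniusSystem

variable (F : FrobeniusSystem ι)

/-- The map `x E(y -)` in `End(M_N)`. -/
noncomputable def rankOne (x y : M) : EndRight ι :=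
  ⟨LinearMap.mulLeft K x ∘ₗ ι.toLinearMap ∘ₗ F.E ∘ₗ LinearMap.mulLeft K y,
    fun m n => by simp [← mul_assoc, F.E_right]⟩

theorem rankOne_apply (x y m : M) : (F.rankOne x y).1 m = x * ι (F.E (y * m)) := rfl

/-- The map `x ⊗ y ↦ x E(y -)` from `M₁` to `End(M_N)`. -/
noncomputable def toEndRight : TSq ι →ₗ[K] EndRight ι :=
  lift (LinearMap.mk₂ K F.rankOne
    (fun x x' y => EndRight.ext fun m => add_mul x x' _)
    (fun k x y => EndRight.ext fun m => smul_mul_assoc k x _)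
    (fun x y y' => EndRight.ext fun m => by
      change _ = (F.rankOne x y).1 m + (F.rankOne x y').1 m
      simp [rankOne_apply, add_mul, mul_add])
    (fun k x y => EndRight.ext fun m => by
      simp [rankOne_apply]))
    (fun x n y => EndRight.ext fun m => by
      simp [rankOne_apply, mul_assoc, F.E_left])

theorem toEndRight_mk (x y m : M) : (F.toEndRight (RingExt.mk ι x y)).1 m = x * ι (F.E (y * m)) := by
  rw [toEndRight, lift_mk]
  rfl

/-- The inverse is `ξ ↦ ∑ ξ(xᵢ) ⊗ yᵢ`; the two dual basis equations of the Frobenius system give the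
two composites. -/
theorem bijective_toEndRight : Function.Bijective F.toEndRight := by
  refine Function.bijective_iff_has_inverse.2
    ⟨fun ξ => ∑ i, RingExt.mk ι (ξ.1 (F.x i)) (F.y i), fun t => ?_, fun ξ => EndRight.ext fun m => ?_⟩
  · change ∑ i, RingExt.mk ι ((F.toEndRight t).1 (F.x i)) (F.y i) = t
    induction t using tsq_induction with
    | hz => simp
    | hmk x y =>
      simp only [toEndRight_mk, mk_balanced]
      rw [← map_sum, F.sum_right]
    | hadd s t hs ht =>
      have h : ∀ (u v : EndRight ι) x, (u + v).1 x = u.1 x + v.1 x := fun _ _ _ => rfl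
      simp only [map_add, h, LinearMap.add_apply, Finset.sum_add_distrib, hs, ht]
  · conv_rhs => rw [← F.sum_left m]
    simp [LinearMap.sum_apply, toEndRight_mk, EndRight.map_right]

theorem toEndRight_mul (s t : TSq ι) :
    F.toEndRight (M₁.mul F s t) = F.toEndRight s * F.toEndRight t := by
  induction s using tsq_induction with
  | hz => simp
  | hadd s s' hs hs' => simp only [map_add, LinearMap.add_apply, hs, hs', add_mul]
  | hmk a b =>
  induction t using tsq_induction with
  | hz => simp
  | hadd s s' hs hs' => simp only [map_add, hs, hs', mul_add]
  | hmk c d =>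
    refine EndRight.ext fun m => ?_
    change _ = (F.toEndRight (RingExt.mk ι a b)).1 ((F.toEndRight (RingExt.mk ι c d)).1 m)
    rw [M₁.mul_mk, toEndRight_mk, toEndRight_mk, toEndRight_mk, ← mul_assoc b, F.E_right,
      map_mul ι, mul_assoc]

/-- The isomorphism `M₁ ≅ End(M_N)`, `x ⊗ y ↦ x E(y -)`. -/
noncomputable def equivEndRight : M₁ F ≃ₐ[K] EndRight ι :=
  AlgEquiv.ofBijective
    (AlgHom.ofLinearMap (A := M₁ F) F.toEndRight
      (EndRight.ext fun m => by
        change (F.toEndRight (∑ i, RingExt.mk ι (F.x i) (F.y i))).1 m = m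
        conv_rhs => rw [← F.sum_left m]
        simp [LinearMap.sum_apply, toEndRight_mk])
      F.toEndRight_mul)
    F.bijective_toEndRight

theorem equivEndRight_tmul (x y m : M) :
    (F.equivEndRight (M₁.tmul F x y)).1 m = x * ι (F.E (y * m)) :=
  F.toEndRight_mk x y m

/-! ### The Frobenius homomorphism of `A` -/

/-- Expanding `m xᵢ` in the `xₖ` produces coefficients `E(yₖ m xᵢ)` in `N`. They cross the tensor
sign and reassemble `yₖ m`. -/
theorem lmul_casimir (m : M) : lmul ι m (∑ i, RingExt.mk ι (F.x i) (F.y i)) =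
    rmul ι m (∑ i, RingExt.mk ι (F.x i) (F.y i)) := by
  have h1 : ∀ i, RingExt.mk ι (m * F.x i) (F.y i) =
      ∑ k, RingExt.mk ι (F.x k) (ι (F.E (F.y k * m * F.x i)) * F.y i) := by
    intro i
    conv_lhs => rw [← F.sum_left (m * F.x i)]
    simp [LinearMap.sum_apply, mk_balanced, mul_assoc]
  simp only [map_sum, lmul_mk, rmul_mk, h1]
  rw [Finset.sum_comm]
  refine Finset.sum_congr rfl fun k _ => ?_
  rw [← map_sum, F.sum_right]

/-- The Casimir element `∑ xⱼ ⊗ yⱼ`, as an element of `B`. -/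
noncomputable def casimir : B ι :=
  ⟨∑ i, RingExt.mk ι (F.x i) (F.y i), fun n => F.lmul_casimir (ι n)⟩

theorem casimir_val : F.casimir.val = ∑ i, RingExt.mk ι (F.x i) (F.y i) := rfl

@[simp] theorem toA_apply (m : M) : F.toA.1 m = ι (F.E m) := rfl

/-- This is `∑ α(xⱼ) E(yⱼ m) = α(m)`. Thus every element of `A` has the form `b¹ E(b² -)`. -/
theorem rightCut_map_casimir (α : A ι) : A.rightCut F.toA (B.map α F.casimir) = α :=
  A.ext fun m => by
    rw [A.rightCut_apply, B.map_val, casimir_val, applyFst_sum, rightActEnd_sum]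
    conv_rhs => rw [← F.sum_left m]
    simp [A.map_right]

end FrobeniusSystem

/-! ### The two pairings of `B` with `A` -/

variable [D : IrrD2 ι]

variable (ι) in
/-- The pairing `⟨b, α⟩ = b¹ α(b²)`. -/
noncomputable def pairing : B ι →ₗ[K] A ι →ₗ[K] K :=
  LinearMap.mk₂ K
    (fun b α => D.irr.scalar _ (A.rightCut_one_comm α b))
    (fun b b' α => D.irr.1 (by
      simp only [map_add, IsIrreducible.algebraMap_scalar, A.rightCut_apply, B.val_add, LinearMap.add_apply]))
    (fun k b α => D.irr.1 (by
      simp only [smul_eq_mul, map_mul, IsIrreducible.algebraMap_scalar, A.rightCut_apply, B.val_smul, map_smul,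
        LinearMap.smul_apply, Algebra.smul_def (A := M)]))
    (fun b α β => D.irr.1 (by
      simp only [map_add, IsIrreducible.algebraMap_scalar, A.rightCut_apply, rightActEnd_add_left]))
    (fun k b α => D.irr.1 (by
      simp only [smul_eq_mul, map_mul, IsIrreducible.algebraMap_scalar, A.rightCut_apply,
        rightActEnd_smul_left, Algebra.smul_def (A := M)]))

theorem algebraMap_pairing (b : B ι) (α : A ι) :
    algebraMap K M (pairing ι b α) = rightActEnd α.1 (A.map_left α) b.val 1 :=
  D.irr.algebraMap_scalar _ (A.rightCut_one_comm α b)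

variable (ι) in
/-- The pairing `[b, α] = α(b¹) b²`. -/
noncomputable def copairing : B ι →ₗ[K] A ι →ₗ[K] K :=
  LinearMap.mk₂ K
    (fun b α => D.irr.scalar _ (A.leftCut_one_comm α b))
    (fun b b' α => D.irr.1 (by
      simp only [map_add, IsIrreducible.algebraMap_scalar, A.leftCut_apply, B.val_add, LinearMap.add_apply]))
    (fun k b α => D.irr.1 (by
      simp only [smul_eq_mul, map_mul, IsIrreducible.algebraMap_scalar, A.leftCut_apply, B.val_smul, map_smul,
        LinearMap.smul_apply, Algebra.smul_def (A := M)]))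
    (fun b α β => D.irr.1 (by
      simp only [map_add, IsIrreducible.algebraMap_scalar, A.leftCut_apply, leftCutEnd_add_left]))
    (fun k b α => D.irr.1 (by
      simp only [smul_eq_mul, map_mul, IsIrreducible.algebraMap_scalar, A.leftCut_apply,
        leftCutEnd_smul_left, Algebra.smul_def (A := M)]))

theorem algebraMap_copairing (b : B ι) (α : A ι) :
    algebraMap K M (copairing ι b α) = leftCutEnd α.1 (A.map_right α) b.val 1 :=
  D.irr.algebraMap_scalar _ (A.leftCut_one_comm α b)

/-- In the expansions over `M` given by a quasibasis, the coefficients `b¹ γᵢ(b²)` and `cᵢ¹ α(cᵢ²)`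
are scalars, so these are expansions over `K`. -/
theorem IsRightQuasibasis.isDualBases {n : ℕ} {c : Fin n → B ι} {γ : Fin n → A ι}
    (h : IsRightQuasibasis c γ) : IsDualBases (pairing ι) c γ where
  sum_left b := B.ext <| by
    conv_rhs => rw [← h.sum_lmul b.val]
    simp only [B.val_sum, B.val_smul, ← algebraMap_pairing, lmul_algebraMap]
  sum_right α := A.ext fun m => by
    have := h.sum_rightActEnd α.1 (A.map_left α) 1 m
    rw [mul_one] at this
    rw [← this]
    simp only [A.sum_apply, A.smul_apply, ← algebraMap_pairing, Algebra.smul_def (A := M),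
      Algebra.commutes]

theorem IsLeftQuasibasis.isDualBases {n : ℕ} {b : Fin n → B ι} {β : Fin n → A ι}
    (h : IsLeftQuasibasis b β) : IsDualBases (copairing ι) b β where
  sum_left d := B.ext <| by
    conv_rhs => rw [← h.sum_rmul d.val]
    simp only [B.val_sum, B.val_smul, ← algebraMap_copairing, rmul_algebraMap]
  sum_right α := A.ext fun m => by
    have := h.sum_leftCutEnd α.1 (A.map_right α) 1 m
    rw [one_mul] at this
    rw [← this]
    simp only [A.sum_apply, A.smul_apply, ← algebraMap_copairing, Algebra.smul_def (A := M)]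

variable (ι) in
theorem A.finite_projective : Module.Finite K (A ι) ∧ Module.Projective K (A ι) :=
  ⟨D.right.isDualBases.flip.finite_left, D.right.isDualBases.flip.projective_left⟩

variable (ι) in
theorem B.finite_projective : Module.Finite K (B ι) ∧ Module.Projective K (B ι) :=
  ⟨D.right.isDualBases.finite_left, D.right.isDualBases.projective_left⟩

/-! ### The Hopf algebra `A` -/

/-- `⟨b b', α⟩ = b'¹ b¹ α(b² b'²)`. -/
theorem algebraMap_pairing_mul (b b' : B ι) (α : A ι) {s s' : Finset (M × M)}
    (hs : b.val = ∑ x ∈ s, mk ι x.1 x.2) (hs' : b'.val = ∑ x ∈ s', mk ι x.1 x.2) :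
    algebraMap K M (pairing ι (b * b') α) =
      ∑ x' ∈ s', ∑ x ∈ s, x'.1 * (x.1 * α.1 (x.2 * x'.2)) := by
  rw [algebraMap_pairing, B.val_mul, hs', map_sum, map_sum, LinearMap.sum_apply]
  refine Finset.sum_congr rfl fun x' _ => ?_
  rw [insert_mk, rightActEnd_lmul, rightActEnd_rmul, hs, rightActEnd_sum, Finset.mul_sum, mul_one]

/-- The scalar `⟨b, α⟩` may be inserted in the middle of `b'¹ β(b'²)`, giving `b'¹ b¹ α(b²) β(b'²)`.
This nesting matches the product of `B`, so `α₁(x) α₂(y) = α(x y)` describes the transposed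
coproduct. -/
theorem algebraMap_pair₂_pairing (b b' : B ι) (t : A ι ⊗[K] A ι) {s s' : Finset (M × M)}
    (hs : b.val = ∑ x ∈ s, mk ι x.1 x.2) (hs' : b'.val = ∑ x ∈ s', mk ι x.1 x.2) :
    algebraMap K M (IsDualBases.pair₂ (pairing ι) b b' t) =
      ∑ x' ∈ s', ∑ x ∈ s, x'.1 * (x.1 * A.eval₂ ι x.2 x'.2 t) := by
  induction t with
  | zero => simp
  | add t t' ht ht' => simp only [map_add, ht, ht', mul_add, Finset.sum_add_distrib]
  | tmul α β =>
    rw [IsDualBases.pair₂_tmul, mul_comm, map_mul, algebraMap_pairing b', hs', rightActEnd_sum,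
      Finset.sum_mul]
    refine Finset.sum_congr rfl fun x' _ => ?_
    rw [mul_one, mul_assoc, ← Algebra.commutes, algebraMap_pairing, hs, rightActEnd_sum,
      Finset.sum_mul, Finset.mul_sum]
    simp [mul_assoc]

noncomputable local instance A.instCoalgebra : Coalgebra K (A ι) := D.right.isDualBases.coalgebra

theorem A.pair₂_comul (b b' : B ι) (α : A ι) :
    IsDualBases.pair₂ (pairing ι) b b' (Coalgebra.comul α) = pairing ι (b * b') α :=
  D.right.isDualBases.pair₂_comul b b' α

theorem A.counit_eq (α : A ι) : Coalgebra.counit (R := K) α = pairing ι 1 α := rfl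

theorem A.algebraMap_counit (α : A ι) : algebraMap K M (Coalgebra.counit (R := K) α) = α.1 1 := by
  rw [A.counit_eq, algebraMap_pairing, B.val_one, rightActEnd_mk]
  simp

/-- The coproduct of `A` is characterized by `α₁(x) α₂(y) = α(x y)`. -/
theorem A.comul_eq {α : A ι} {t : A ι ⊗[K] A ι} (h : ∀ x y, A.eval₂ ι x y t = α.1 (x * y)) :
    Coalgebra.comul (R := K) α = t := by
  refine D.right.isDualBases.ext₂ fun b b' => D.irr.1 ?_
  obtain ⟨s, hs⟩ := tsq_exists_sum b.val
  obtain ⟨s', hs'⟩ := tsq_exists_sum b'.val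
  rw [A.pair₂_comul, algebraMap_pair₂_pairing b b' _ hs hs',
    algebraMap_pairing_mul b b' _ hs hs']
  simp only [h]

theorem A.eval₂_comul (x y : M) (α : A ι) :
    A.eval₂ ι x y (Coalgebra.comul (R := K) α) = α.1 (x * y) := by
  rw [A.comul_eq (D.right.eval₂_sum α)]
  exact D.right.eval₂_sum α x y

noncomputable local instance A.instBialgebra : Bialgebra K (A ι) :=
  Bialgebra.mk' K (A ι) (D.irr.1 (by simp [A.algebraMap_counit]))
    (by
      intro α β
      refine D.irr.1 ?_
      -- As `β(1)` is a scalar, `α(β(1)) = β(1) α(1)`.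
      rw [mul_comm (Coalgebra.counit α), map_mul (algebraMap K M), A.algebraMap_counit, A.mul_apply,
        ← A.algebraMap_counit β, Algebra.algebraMap_eq_smul_one, map_smul, smul_one_mul, A.algebraMap_counit])
    (A.comul_eq (by simp [Algebra.TensorProduct.one_def]))
    (by
      intro α β
      refine A.comul_eq fun x y => ?_
      rw [A.eval₂_mul (fun x y => A.eval₂_comul x y α), A.eval₂_comul, A.mul_apply])

variable (ι) in
/-- The antipode of `A`, characterized by `⟨b, S(α)⟩ = [b, α]`. -/
noncomputable def A.S : A ι →ₗ[K] A ι :=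
  ∑ i, ((copairing ι) (D.c i)).smulRight (D.γ i)

/-- Paired with `b`, the sum gives `[b, α]` for any right quasibasis, hence it does not depend on
the chosen one. -/
theorem IsRightQuasibasis.S_eq {n : ℕ} {c : Fin n → B ι} {γ : Fin n → A ι}
    (h : IsRightQuasibasis c γ) (α : A ι) : A.S ι α = ∑ i, copairing ι (c i) α • γ i := by
  refine D.right.isDualBases.ext_right fun b => ?_
  have key : ∀ {n : ℕ} {c : Fin n → B ι} {γ : Fin n → A ι} (h : IsRightQuasibasis c γ),
      pairing ι b (∑ i, copairing ι (c i) α • γ i) = copairing ι b α := by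
    intro n c γ h
    conv_rhs => rw [← h.isDualBases.sum_left b]
    simp [mul_comm]
  rw [key h, ← key D.right]
  simp [A.S]

theorem pairing_S (b : B ι) (α : A ι) : pairing ι b (A.S ι α) = copairing ι b α := by
  conv_rhs => rw [← D.right.isDualBases.sum_left b]
  simp [A.S, mul_comm]

/-- `⟨b, S(α) α'⟩ = α(b¹) α'(b²)`. -/
theorem algebraMap_pairing_S_mul (b : B ι) (α α' : A ι) {s : Finset (M × M)}
    (hs : b.val = ∑ x ∈ s, mk ι x.1 x.2) :
    algebraMap K M (pairing ι b (A.S ι α * α')) = ∑ x ∈ s, α.1 x.1 * α'.1 x.2 := by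
  have h1 : A.S ι α * α' = ∑ i, copairing ι (D.c i) α • (D.γ i * α') := by
    rw [D.right.S_eq, Finset.sum_mul]
    exact Finset.sum_congr rfl fun i _ => smul_mul_assoc _ _ _
  -- The scalar `⟨b, γᵢ α'⟩` is moved inside `α`. The sum `∑ α(b¹ γᵢ(α'(b²)) cᵢ¹) cᵢ²` then
  -- collapses to `α(b¹) α'(b²)` by the right quasibasis equation.
  have h2 : ∀ i, algebraMap K M (copairing ι (D.c i) α * pairing ι b (D.γ i * α')) =
      leftCutEnd α.1 (A.map_right α) (D.c i).val
        (algebraMap K M (pairing ι b (D.γ i * α'))) := by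
    intro i
    rw [map_mul, algebraMap_copairing, ← Algebra.commutes, Algebra.algebraMap_eq_smul_one,
      map_smul, smul_one_mul]
  simp only [h1, map_sum, map_smul, smul_eq_mul]
  simp only [h2, algebraMap_pairing]
  simp only [hs, rightActEnd_sum]
  simp only [map_sum, A.mul_apply, mul_one]
  rw [Finset.sum_comm]
  simp only [D.right.sum_leftCutEnd]

-- Paired with `b`, the element `S(α₁) α₂` gives `α₁(b¹) α₂(b²) = α(b¹ b²) = ε(α) ε(b)`. Evaluated
-- at `m`, the element `α₁ S(α₂)` gives `∑ α(γᵢ(m) cᵢ¹) cᵢ² = α(1) m`.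
noncomputable local instance A.hopfAlgebra : HopfAlgebra K (A ι) where
  antipode := A.S ι
  mul_antipode_rTensor_comul := by
    ext1 α
    refine D.right.isDualBases.ext_right fun b => D.irr.1 ?_
    obtain ⟨s, hs⟩ := tsq_exists_sum b.val
    have key : ∀ t : A ι ⊗[K] A ι, algebraMap K M (pairing ι b
        (LinearMap.mul' K (A ι) ((A.S ι).rTensor (A ι) t))) =
        ∑ x ∈ s, A.eval₂ ι x.1 x.2 t := by
      intro t
      induction t with
      | zero => simp
      | add t t' ht ht' => simp only [map_add, ht, ht', Finset.sum_add_distrib]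
      | tmul α β =>
        simp only [LinearMap.rTensor_tmul, LinearMap.mul'_apply, A.eval₂_tmul]
        exact algebraMap_pairing_S_mul b α β hs
    simp only [LinearMap.comp_apply, key, A.eval₂_comul, Algebra.linearMap_apply]
    have h1 : algebraMap K M (pairing ι b 1) = ∑ x ∈ s, x.1 * x.2 := by
      rw [algebraMap_pairing, hs, rightActEnd_sum]
      simp
    rw [Algebra.algebraMap_eq_smul_one (A := A ι), map_smul, smul_eq_mul, mul_comm, map_mul,
      A.algebraMap_counit, ← map_sum, ← h1, Algebra.algebraMap_eq_smul_one, map_smul,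
      smul_one_mul]
  mul_antipode_lTensor_comul := by
    ext1 α
    refine A.ext fun m => ?_
    choose s hs using fun i => tsq_exists_sum (D.c i).val
    have key : ∀ t : A ι ⊗[K] A ι,
        (LinearMap.mul' K (A ι) ((A.S ι).lTensor (A ι) t)).1 m =
        ∑ i, ∑ y ∈ s i, A.eval₂ ι ((D.γ i).1 m) y.1 t * y.2 := by
      intro t
      induction t with
      | zero => simp
      | add t t' ht ht' =>
        simp only [map_add, A.add_apply, ht, ht', add_mul, Finset.sum_add_distrib]
      | tmul α β =>
        rw [LinearMap.lTensor_tmul, LinearMap.mul'_apply, A.mul_apply, D.right.S_eq, A.sum_apply,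
          map_sum]
        refine Finset.sum_congr rfl fun i _ => ?_
        rw [A.smul_apply, map_smul, Algebra.smul_def, Algebra.commutes, algebraMap_copairing,
          hs, leftCutEnd_sum, Finset.mul_sum]
        simp [mul_assoc]
    have h := D.right.sum_leftCutEnd α.1 (A.map_right α) 1 m
    simp only [hs, leftCutEnd_sum, one_mul] at h
    simp only [LinearMap.comp_apply, key, A.eval₂_comul, Algebra.linearMap_apply, h]
    rw [Algebra.algebraMap_eq_smul_one, A.smul_apply, Algebra.smul_def, A.algebraMap_counit,
      A.one_apply]

/-! ### The dual Hopf algebra `B` -/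

variable (ι) in
/-- The antipode of `B`, characterized by `⟨S(b), α⟩ = [b, α]`. -/
noncomputable def B.S : B ι →ₗ[K] B ι :=
  ∑ i, ((copairing ι).flip (D.γ i)).smulRight (D.c i)

theorem pairing_S_left (b : B ι) (α : A ι) : pairing ι (B.S ι b) α = copairing ι b α := by
  conv_rhs => rw [← D.right.isDualBases.sum_right α]
  simp [B.S, mul_comm]

theorem antipode_eq (α : A ι) : HopfAlgebra.antipode K α = A.S ι α := rfl

-- The antipodes are adjoint because `⟨S(b), α⟩` and `⟨b, S(α)⟩` both equal `[b, α]`.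
noncomputable local instance B.hopfAlgebra : HopfAlgebra K (B ι) :=
  D.right.isDualBases.hopfAlgebra (fun b b' α => (A.pair₂_comul b b' α).symm) (fun _ => rfl)
    (B.S ι) (fun b α => by rw [pairing_S_left, antipode_eq, pairing_S])

theorem B.pair₂_comul (α α' : A ι) (b : B ι) :
    IsDualBases.pair₂ (pairing ι).flip α α' (Coalgebra.comul b) = pairing ι b (α * α') :=
  D.right.isDualBases.flip.pair₂_comul α α' b

variable (ι) in
theorem isHopfDuality_pairing : IsHopfDuality (pairing ι) where
  perfect := D.right.isDualBases.isPerfPair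
  mul_left b b' α := (A.pair₂_comul b b' α).symm
  mul_right b α α' := (B.pair₂_comul α α' b).symm
  one_left _ := rfl
  one_right _ := rfl
  antipode b α := by
    rw [antipode_eq, pairing_S]
    exact pairing_S_left b α

theorem B.algebraMap_counit (b : B ι) :
    algebraMap K M (Coalgebra.counit (R := K) b) = multM b.val := by
  change algebraMap K M (pairing ι b 1) = _
  rw [algebraMap_pairing]
  generalize b.val = t
  induction t using tsq_induction with
  | hz => simp
  | hmk x y => simp [rightActEnd_mk, multM]
  | hadd s t hs ht => simp only [map_add, LinearMap.add_apply, hs, ht]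

/-- The inverse of the antipode of `A` is `α ↦ ∑ bᵢ¹ α(bᵢ²) βᵢ`. -/
theorem IsLeftQuasibasis.S_sum {n : ℕ} {b : Fin n → B ι} {β : Fin n → A ι}
    (h : IsLeftQuasibasis b β) (α : A ι) : A.S ι (∑ i, pairing ι (b i) α • β i) = α := by
  refine D.right.isDualBases.ext_right fun d => ?_
  rw [pairing_S]
  conv_rhs => rw [← h.isDualBases.sum_left d]
  simp [mul_comm]

/-- Writing `α = S(∑ ⟨bᵢ, α⟩ βᵢ)` turns `⟨d, α α'⟩` into `∑ ⟨bᵢ, α⟩ βᵢ(d¹) α'(d²)`, which is the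
pairing of `α ⊗ α'` with the right-hand side. -/
theorem IsLeftQuasibasis.comul_B {n : ℕ} {b : Fin n → B ι} {β : Fin n → A ι}
    (h : IsLeftQuasibasis b β) (d : B ι) :
    Coalgebra.comul (R := K) d = ∑ i, b i ⊗ₜ[K] B.map (β i) d := by
  refine D.right.isDualBases.flip.ext₂ fun α α' => D.irr.1 ?_
  rw [B.pair₂_comul, ← h.S_sum α]
  obtain ⟨s, hs⟩ := tsq_exists_sum d.val
  rw [algebraMap_pairing_S_mul d _ _ hs]
  simp only [map_sum, IsDualBases.pair₂_tmul, LinearMap.flip_apply, h.S_sum, map_mul,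
    algebraMap_pairing _ α']
  simp only [B.map_val, hs, applyFst_sum, rightActEnd_sum, A.sum_apply,
    A.smul_apply, Finset.sum_mul, Finset.mul_sum, mul_one]
  rw [Finset.sum_comm]
  refine Finset.sum_congr rfl fun i _ => Finset.sum_congr rfl fun x _ => ?_
  rw [Algebra.smul_def, mul_assoc]

/-! ### Module algebras and smash products -/

theorem isLeftModuleAlgebra_act : IsLeftModuleAlgebra (A.act ι) where
  one_act _ := rfl
  mul_act _ _ _ := rfl
  act_mul α x y := (A.eval₂_comul x y α).symm
  act_one α := by rw [A.act_apply, ← A.algebraMap_counit, Algebra.algebraMap_eq_smul_one]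

theorem isRightModuleAlgebra_act :
    IsRightModuleAlgebra (H := B ι) (X := EndLeft ι) (EndLeft.act ι) where
  act_one' ξ := EndLeft.ext fun m => by
    rw [EndLeft.act_apply, rightAct_apply, B.val_one, rightActEnd_mk, one_mul, one_mul]
  act_mul' b b' ξ := EndLeft.ext fun m => by
    obtain ⟨s, hs⟩ := tsq_exists_sum b'.val
    simp only [EndLeft.act_apply]
    rw [rightAct_apply_of_sum _ b' hs, rightAct_apply, B.val_mul, hs, map_sum, map_sum,
      LinearMap.sum_apply]
    refine Finset.sum_congr rfl fun x _ => ?_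
    rw [insert_mk, rightActEnd_lmul, rightActEnd_rmul, rightAct_apply]
  mul_act' b ξ η := EndLeft.ext fun m => by
    obtain ⟨s, hs⟩ := tsq_exists_sum b.val
    rw [D.left.comul_B b, map_sum, map_sum, EndLeft.act_apply, rightAct_apply_of_sum _ b hs]
    have h1 : (∑ i, LinearMap.mul' K (EndLeft ι) (TensorProduct.map ((EndLeft.act ι).flip ξ)
        ((EndLeft.act ι).flip η) (D.b i ⊗ₜ[K] B.map (D.β i) b)) : EndLeft ι).1 m =
        ∑ i, (rightAct ξ (D.b i)).1 ((rightAct η (B.map (D.β i) b)).1 m) := by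
      simp [LinearMap.sum_apply]
    rw [h1]
    -- The sum is `∑ bᵢ¹ ξ(bᵢ² βᵢ(b¹) η(b² m))`, and the left quasibasis reduces it to `b¹ ξ(η(b²
    -- m))`.
    simp only [rightAct_apply η, B.map_val, hs, applyFst_sum, rightActEnd_sum]
    simp only [map_sum]
    rw [Finset.sum_comm]
    refine Finset.sum_congr rfl fun x _ => ?_
    simp only [rightAct_apply]
    rw [D.left.sum_rightActEnd]
    rfl
  one_act' b := EndLeft.ext fun m => by
    obtain ⟨s, hs⟩ := tsq_exists_sum b.val
    rw [EndLeft.act_apply, rightAct_apply_of_sum _ b hs]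
    change _ = Coalgebra.counit (R := K) b • m
    rw [Algebra.smul_def, B.algebraMap_counit, hs, map_sum, Finset.sum_mul]
    exact Finset.sum_congr rfl fun x _ => by simp [multM, mul_assoc]

/-- The inverse is `ξ ↦ ∑ ξ(bᵢ¹) bᵢ² ⊗ βᵢ`. On `m α(-)` the first factor is `m [bᵢ, α]`; the scalar
crosses to `βᵢ` and the dual bases restore `α`. -/
theorem bijective_mulAct : Function.Bijective (mulAct ι) := by
  choose s hs using fun i => tsq_exists_sum (D.b i).val
  have hsum : ∀ (i) (ξ : EndRight ι), ∑ x ∈ s i, ξ.1 x.1 * x.2 =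
      leftCutEnd ξ.1 (EndRight.map_right ξ) (D.b i).val 1 := by
    intro i ξ
    rw [hs, leftCutEnd_sum]
    simp
  let g : EndRight ι →ₗ[K] M ⊗[K] A ι :=
    { toFun := fun ξ => ∑ i, (∑ x ∈ s i, ξ.1 x.1 * x.2) ⊗ₜ[K] D.β i
      map_add' := fun ξ η => by
        simp [add_mul, Finset.sum_add_distrib, TensorProduct.add_tmul]
      map_smul' := fun k ξ => by
        simp only [EndRight.smul_apply, smul_mul_assoc, ← Finset.smul_sum,
          ← TensorProduct.smul_tmul', RingHom.id_apply] }
  have hg : ∀ ξ, g ξ = ∑ i, (∑ x ∈ s i, ξ.1 x.1 * x.2) ⊗ₜ[K] D.β i := fun _ => rfl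
  refine Function.bijective_iff_has_inverse.2 ⟨g, fun t => ?_, fun ξ => EndRight.ext fun m => ?_⟩
  · induction t with
    | zero => simp
    | add t t' ht ht' => rw [map_add, map_add, ht, ht']
    | tmul m α =>
      have h : ∀ i, ∑ x ∈ s i, (mulAct ι (m ⊗ₜ α)).1 x.1 * x.2 = copairing ι (D.b i) α • m := by
        intro i
        rw [Algebra.smul_def, Algebra.commutes, algebraMap_copairing, hs, leftCutEnd_sum,
          Finset.mul_sum]
        simp [mul_assoc]
      simp only [hg, h, TensorProduct.smul_tmul, ← TensorProduct.tmul_sum,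
        D.left.isDualBases.sum_right]
  · have h := D.left.sum_leftCutEnd ξ.1 (EndRight.map_right ξ) 1 m
    rw [one_mul] at h
    rw [← h]
    simp only [hg, map_sum, hsum]
    simp [LinearMap.sum_apply]

theorem mulAct_left (m : M) (t : M ⊗[K] A ι) (x : M) :
    (mulAct ι (Smash.left m t)).1 x = m * (mulAct ι t).1 x := by
  induction t with
  | zero => simp
  | add t t' ht ht' =>
    have h : ∀ u v : EndRight ι, (u + v).1 x = u.1 x + v.1 x := fun _ _ => rfl
    rw [map_add, map_add, map_add, h, h, ht, ht', mul_add]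
  | tmul y α => simp [Smash.left, mul_assoc]

/-- This is `α(m α'(x)) = α₁(m) α₂(α'(x))`: the diagonal action becomes composition with `α`. -/
theorem mulAct_diag (α : A ι) (t : M ⊗[K] A ι) (x : M) :
    (mulAct ι (Smash.diag (A.act ι) α t)).1 x = α.1 ((mulAct ι t).1 x) := by
  have h : ∀ u v : EndRight ι, (u + v).1 x = u.1 x + v.1 x := fun _ _ => rfl
  induction t with
  | zero => simp
  | add t t' ht ht' =>
    rw [map_add, map_add, map_add, h, h, ht, ht', map_add]
  | tmul m α' =>
    rw [mulAct_tmul, ← A.eval₂_comul]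
    simp only [Smash.diag, LinearMap.comp_apply]
    generalize Coalgebra.comul (R := K) α = t
    induction t with
    | zero => simp
    | add t t' ht ht' =>
      simp only [map_add, LinearMap.add_apply, h, ht, ht']
    | tmul β β' => simp

theorem mulAct_mul (s t : M ⊗[K] A ι) :
    mulAct ι (Smash.mul (A.act ι) s t) = mulAct ι s * mulAct ι t := by
  induction s with
  | zero => simp
  | add s s' hs hs' => simp only [map_add, LinearMap.add_apply, hs, hs', add_mul]
  | tmul m α =>
    refine EndRight.ext fun x => ?_
    rw [Smash.mul_tmul, Module.End.mul_apply, mulAct_left, mulAct_diag]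
    rfl

variable (ι) in
/-- The isomorphism `M ⋊ A ≅ End(M_N)`, `m ⋊ α ↦ m α(-)`. -/
noncomputable def smashEquivEndRight :
    SmashProduct (isLeftModuleAlgebra_act (ι := ι)) ≃ₐ[K] EndRight ι :=
  AlgEquiv.ofBijective
    (AlgHom.ofLinearMap (A := SmashProduct (isLeftModuleAlgebra_act (ι := ι))) (mulAct ι)
      (EndRight.ext fun x => by
        change (mulAct ι (1 ⊗ₜ 1)).1 x = x
        simp)
      mulAct_mul)
    bijective_mulAct

theorem smashEquivEndRight_mk (m : M) (α : A ι) (x : M) :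
    (smashEquivEndRight ι (SmashProduct.mk _ m α)).1 x = m * α.1 x := rfl

/-! ### The Frobenius homomorphism `ψ` and the antipode formula -/

namespace FrobeniusSystem

variable (F : FrobeniusSystem ι)

/-- The Frobenius homomorphism `ψ(α) = ∑ α(xⱼ) yⱼ` of `A`. -/
noncomputable def ψ : A ι →ₗ[K] K := copairing ι F.casimir

theorem algebraMap_ψ (α : A ι) : algebraMap K M (F.ψ α) = ∑ j, α.1 (F.x j) * F.y j := by
  rw [ψ, algebraMap_copairing, casimir_val, leftCutEnd_sum]
  simp

theorem ψ_mul (α β : A ι) : F.ψ (α * β) = copairing ι (B.map β F.casimir) α := D.irr.1 <| by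
  rw [algebraMap_ψ, algebraMap_copairing, B.map_val, casimir_val, applyFst_sum, leftCutEnd_sum]
  simp

/-- The factor `E(b² xⱼ)` leaves `α` by right `N`-linearity, and `∑ E(b² xⱼ) yⱼ = b²`. -/
theorem ψ_mul_rightCut (α : A ι) (b : B ι) :
    F.ψ (α * A.rightCut F.toA b) = copairing ι b α := D.irr.1 <| by
  obtain ⟨s, hs⟩ := tsq_exists_sum b.val
  rw [algebraMap_ψ, algebraMap_copairing, hs, leftCutEnd_sum]
  simp only [A.mul_apply, A.rightCut_apply, hs, rightActEnd_sum, toA_apply]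
  simp only [map_sum, A.map_right, one_mul, Finset.sum_mul, mul_assoc]
  rw [Finset.sum_comm]
  refine Finset.sum_congr rfl fun x _ => ?_
  rw [← Finset.mul_sum]
  rw [F.sum_right]

/-- The Frobenius system of `A` over `K` with Frobenius homomorphism `ψ`. -/
noncomputable def dual : FrobeniusSystem (Algebra.ofId K (A ι)) where
  E := F.ψ
  E_left k α := by rw [Algebra.ofId_apply, ← Algebra.smul_def, map_smul, smul_eq_mul]
  E_right α k := by
    rw [Algebra.ofId_apply, ← Algebra.commutes, ← Algebra.smul_def, map_smul, smul_eq_mul,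
      mul_comm]
  size := D.leftSize
  x i := A.rightCut F.toA (D.b i)
  y := D.β
  sum_left α := by
    have hlin : ∀ f : Fin D.leftSize → K, ∑ i, f i • A.rightCut F.toA (D.b i) =
        A.rightCut F.toA (∑ i, f i • D.b i) := by
      refine fun f => A.ext fun m => ?_
      rw [A.sum_apply]
      simp [A.rightCut_apply, B.val_sum, LinearMap.sum_apply]
    -- Here `ψ(βᵢ α) = [d, βᵢ]` with `d = ∑ α(xⱼ) ⊗ yⱼ`. The sum of the `[d, βᵢ] bᵢ` is `d`, and
    -- cutting `E` by `d` returns `α`.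
    simp only [Algebra.ofId_apply, ← Algebra.commutes, ← Algebra.smul_def, ψ_mul]
    rw [hlin, D.left.isDualBases.sum_left, rightCut_map_casimir]
  sum_right α := by
    simp only [Algebra.ofId_apply, ← Algebra.smul_def, ψ_mul_rightCut]
    exact D.left.isDualBases.sum_right α

/-- At `m` the left side is `∑ α(m xⱼ) yⱼ`, and the Casimir element commutes with `m`. -/
theorem rid_lTensor_ψ_comul (α : A ι) :
    TensorProduct.rid K (A ι) (F.ψ.lTensor (A ι) (Coalgebra.comul (R := K) α)) = F.ψ α • 1 := by
  refine A.ext fun m => ?_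
  have key : ∀ t, (TensorProduct.rid K (A ι) (F.ψ.lTensor (A ι) t)).1 m =
      ∑ j, A.eval₂ ι m (F.x j) t * F.y j := by
    intro t
    induction t with
    | zero => simp [LinearEquiv.map_zero]
    | add t t' ht ht' =>
      rw [rid_lTensor_add]
      simp only [map_add, A.add_apply, ht, ht', add_mul, Finset.sum_add_distrib]
    | tmul α β =>
      rw [LinearMap.lTensor_tmul, TensorProduct.rid_tmul, A.smul_apply, Algebra.smul_def,
        Algebra.commutes, algebraMap_ψ, Finset.mul_sum]
      simp [mul_assoc]
  have h := congr(leftCutEnd α.1 (A.map_right α) $(F.lmul_casimir m) 1)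
  rw [leftCutEnd_lmul, leftCutEnd_rmul, leftCutEnd_sum, leftCutEnd_sum] at h
  simp only [one_mul] at h
  simp only [key, A.eval₂_comul]
  rw [h, A.smul_apply, Algebra.smul_def, algebraMap_ψ, A.one_apply]

theorem ψ_mul_toA (α : A ι) : F.ψ (α * F.toA) = Coalgebra.counit (R := K) α := D.irr.1 <| by
  rw [algebraMap_ψ, A.algebraMap_counit]
  have h : ∀ n, α.1 (ι n) = α.1 1 * ι n := fun n => by rw [← A.map_right, one_mul]
  have h1 := F.sum_right 1
  simp only [one_mul] at h1
  simp only [A.mul_apply, toA_apply, h, mul_assoc]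
  rw [← Finset.mul_sum, h1, mul_one]

/-- With the right quasibasis form of the coproduct of `E`, the contraction is `∑ ψ(α ∘ cᵢ¹E(cᵢ² -))
γᵢ = ∑ [cᵢ, α] γᵢ`. -/
theorem antipode_eq_rid_lTensor (α : A ι) : HopfAlgebra.antipode K α = TensorProduct.rid K (A ι)
    ((F.ψ ∘ₗ LinearMap.mulLeft K α).lTensor (A ι) (Coalgebra.comul (R := K) F.toA)) := by
  rw [antipode_eq, D.right.S_eq, A.comul_eq (D.right.eval₂_sum F.toA), rid_lTensor_sum]
  simp [ψ_mul_rightCut]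

end FrobeniusSystem

theorem IsLeftQuasibasis.antipode_apply {n : ℕ} {b : Fin n → B ι} {β : Fin n → A ι}
    (h : IsLeftQuasibasis b β) (F : FrobeniusSystem ι) (α : A ι) (m : M) :
    (HopfAlgebra.antipode K α).1 m =
      ∑ i, ∑ j, (A.leftCut F.toA (b i)).1 m * α.1 ((β i).1 (F.x j)) * F.y j := by
  rw [F.antipode_eq_rid_lTensor, A.comul_eq (h.eval₂_sum F.toA), rid_lTensor_sum,
    A.sum_apply]
  refine Finset.sum_congr rfl fun i _ => ?_
  rw [A.smul_apply, Algebra.smul_def,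
    Algebra.commutes, LinearMap.comp_apply, LinearMap.mulLeft_apply, F.algebraMap_ψ,
    Finset.mul_sum]
  simp [mul_assoc]

end RingExt

/-! ### The main theorem -/

theorem mainTheorem9 {K N M : Type*} [CommRing K] [Ring N] [Ring M] [Algebra K N] [Algebra K M]
    (ι : N →ₐ[K] M) (hirr : RingExt.IsIrreducible ι) (hfrob : RingExt.IsFrobenius ι)
    (hd2 : RingExt.IsDepthTwo ι) :
    ∃ (_ : HopfAlgebra K (RingExt.A ι)) (_ : HopfAlgebra K (RingExt.B ι)),
      -- the scalar multiplications are the natural ones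
      (∀ (k : K) (α : RingExt.A ι), (k • α).1 = k • α.1) ∧
      (∀ (k : K) (b : RingExt.B ι), (k • b).val = k • b.val) ∧
      -- `A` and `B` are finitely generated projective over `K`
      (Module.Finite K (RingExt.A ι) ∧ Module.Projective K (RingExt.A ι)) ∧
      (Module.Finite K (RingExt.B ι) ∧ Module.Projective K (RingExt.B ι)) ∧
      -- the counits `ε(α) = α(1)` and `ε(b) = b¹ b²`
      (∀ α : RingExt.A ι, algebraMap K M (Coalgebra.counit (R := K) α) = α.1 1) ∧
      (∀ b : RingExt.B ι, algebraMap K M (Coalgebra.counit (R := K) b) = RingExt.multM b.val) ∧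
      -- the coproducts, in terms of left and right D2 quasibases
      (∀ (n : ℕ) (b : Fin n → RingExt.B ι) (β : Fin n → RingExt.A ι),
        RingExt.IsLeftQuasibasis b β →
          (∀ α : RingExt.A ι, Coalgebra.comul (R := K) α =
            ∑ i, RingExt.A.leftCut α (b i) ⊗ₜ[K] β i) ∧
          (∀ d : RingExt.B ι, Coalgebra.comul (R := K) d =
            ∑ i, b i ⊗ₜ[K] RingExt.B.map (β i) d)) ∧
      (∀ (n : ℕ) (c : Fin n → RingExt.B ι) (γ : Fin n → RingExt.A ι),
        RingExt.IsRightQuasibasis c γ →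
          ∀ α : RingExt.A ι, Coalgebra.comul (R := K) α =
            ∑ i, γ i ⊗ₜ[K] RingExt.A.rightCut α (c i)) ∧
      -- `A` and `B` are dual Hopf algebras under the pairing `⟨b, α⟩ = b¹ α(b²)`
      (∃ p : RingExt.B ι →ₗ[K] RingExt.A ι →ₗ[K] K,
        (∀ b α, algebraMap K M (p b α) = (RingExt.A.rightCut α b).1 1) ∧ IsHopfDuality p) ∧
      -- `A` acts on `M` by evaluation, and `M ⋊ A` is isomorphic to `End(M_N)` and to `M₁`
      (∃ act : RingExt.A ι →ₗ[K] M →ₗ[K] M, (∀ α m, act α m = α.1 m) ∧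
        ∃ hact : IsLeftModuleAlgebra act,
          (∃ e : SmashProduct hact ≃ₐ[K] RingExt.EndRight ι,
            ∀ m α x, (e (SmashProduct.mk hact m α)).1 x = m * α.1 x) ∧
          ∀ F : RingExt.FrobeniusSystem ι, ∃ e : SmashProduct hact ≃ₐ[K] RingExt.M₁ F,
            ∀ m α, e (SmashProduct.mk hact m α) =
              ∑ i, RingExt.M₁.tmul F (m * α.1 (F.x i)) (F.y i)) ∧
      -- `B` acts on `End(_N M)` from the right by `ξ ◁ b = b¹ ξ(b² -)`
      (∃ act : RingExt.B ι →ₗ[K] RingExt.EndLeft ι →ₗ[K] RingExt.EndLeft ι,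
        (∀ b ξ, act b ξ = RingExt.rightAct ξ b) ∧ 
          IsRightModuleAlgebra (H := RingExt.B ι) (X := RingExt.EndLeft ι) act) ∧
      -- the antipode of `A`: `ψ(α) = ∑ α(xⱼ) yⱼ` is a Frobenius homomorphism `A → K` with
      -- `α₁ ψ(α₂) = ψ(α) 1` and left norm `E`, and `S(α) = E₁ ψ(α E₂)`
      (∀ F : RingExt.FrobeniusSystem ι, ∃ ψ : RingExt.A ι →ₗ[K] K,
        (∀ α, algebraMap K M (ψ α) = ∑ j, α.1 (F.x j) * F.y j) ∧
        (∃ G : RingExt.FrobeniusSystem (Algebra.ofId K (RingExt.A ι)), G.E = ψ) ∧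
        (∀ α, TensorProduct.rid K (RingExt.A ι)
          (ψ.lTensor (RingExt.A ι) (Coalgebra.comul (R := K) α)) = ψ α • 1) ∧
        (∀ α, ψ (α * F.toA) = Coalgebra.counit (R := K) α) ∧
        (∀ α, HopfAlgebra.antipode K α = TensorProduct.rid K (RingExt.A ι)
          ((ψ ∘ₗ LinearMap.mulLeft K α).lTensor (RingExt.A ι)
            (Coalgebra.comul (R := K) F.toA))) ∧
        ∀ (n : ℕ) (b : Fin n → RingExt.B ι) (β : Fin n → RingExt.A ι),
          RingExt.IsLeftQuasibasis b β →
            ∀ (α : RingExt.A ι) (m : M), (HopfAlgebra.antipode K α).1 m =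
              ∑ i, ∑ j, (RingExt.A.leftCut F.toA (b i)).1 m *
                α.1 ((β i).1 (F.x j)) * F.y j) := by
  obtain ⟨_, b, β, hb⟩ := hd2.1.exists_quasibasis
  obtain ⟨_, c, γ, hc⟩ := hd2.2.exists_quasibasis
  let D : RingExt.IrrD2 ι := ⟨hirr, _, b, β, hb, _, c, γ, hc⟩
  refine ⟨RingExt.A.hopfAlgebra, RingExt.B.hopfAlgebra, fun _ _ => rfl, fun _ _ => rfl,
    RingExt.A.finite_projective ι, RingExt.B.finite_projective ι,
    RingExt.A.algebraMap_counit, RingExt.B.algebraMap_counit,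
    fun n b β h => ⟨fun α => RingExt.A.comul_eq (h.eval₂_sum α), h.comul_B⟩,
    fun n c γ h α => RingExt.A.comul_eq (h.eval₂_sum α),
    ⟨RingExt.pairing ι, RingExt.algebraMap_pairing, RingExt.isHopfDuality_pairing ι⟩,
    ⟨RingExt.A.act ι, fun _ _ => rfl, RingExt.isLeftModuleAlgebra_act,
      ⟨RingExt.smashEquivEndRight ι, RingExt.smashEquivEndRight_mk⟩, fun F =>
      ⟨(RingExt.smashEquivEndRight ι).trans F.equivEndRight.symm, fun m α => ?_⟩⟩,
    ⟨RingExt.EndLeft.act ι, fun _ _ => rfl, RingExt.isRightModuleAlgebra_act⟩,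
    fun F => ⟨F.ψ, F.algebraMap_ψ, ⟨F.dual, rfl⟩, F.rid_lTensor_ψ_comul, F.ψ_mul_toA,
      F.antipode_eq_rid_lTensor, fun n b β h => h.antipode_apply F⟩⟩
  -- Compared inside `End(M_N)`, the claim is `m α(x) = ∑ m α(xᵢ) E(yᵢ x)`.
  rw [AlgEquiv.trans_apply, AlgEquiv.symm_apply_eq, map_sum]
  refine RingExt.EndRight.ext fun x => ?_
  conv_lhs => rw [RingExt.smashEquivEndRight_mk, ← F.sum_left x]
  simp [LinearMap.sum_apply, RingExt.FrobeniusSystem.equivEndRight_tmul, RingExt.A.map_right,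
    Finset.mul_sum, mul_assoc]
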